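/- **Setting.** Let $\bar w\in\mathbb R^{d_1}$, $\bar x\in\mathbb R^{d_2}$ be nonzero with $\|\bar w\|_2=\|\bar x\|_2$, put $M=\|\bar w\bar x^\top\|_F$, and let $\nu\ge 1$. Let $\mathcal I_{\rm out}\subseteq\{1,\dots,m\}$ be a fixed set with $p_{\rm fail}=|\mathcal I_{\rm out}|/m<1/2$. We observe $y_i=\langle \ell_i,\bar w\rangle\langle r_i,\bar x\rangle$ for $i\notin\mathcal I_{\rm out}$ and $y_i=\xi_i$ for $i\in\mathcal I_{\rm out}$, where the $\xi_i$ are arbitrary, possibly random and possibly dependent on the $\ell_j,r_j$. The pairs $(\ell_i,r_i)$, $i=1,\dots,m$, are i.i.d. copies of a pair $(\ell,r)$ of independent random vectors in $\mathbb R^{d_1}$ and $\mathbb R^{d_2}$ that are $\eta$-sub-gaussian, i.e. $\mathbb E\exp(\langle u,\ell\rangle^2/\eta^2)\le 2$ and $\mathbb E\exp(\langle v,r\rangle^2/\eta^2)\le 2$ for all unit vectors $u,v$, and such that $\mathbb P(|\ell^\top Xr|\ge\mu_0)\ge p_0$ for every $X\in\mathbb R^{d_1\times d_2}$ with $\operatorname{rank}X\le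 2$ and $\|X\|_F=1$; here $\eta,\mu_0,p_0>0$. Consider the problem of minimizing $$f(w,x)=\frac1m\sum_{i=1}^m|\langle \ell_i,w\rangle\langle r_i,x\rangle-y_i|\quad\text{over}\quad \mathcal S_\nu=\{(w,x):\|w\|_2\le\nu\sqrt M,\ \|x\|_2\le\nu\sqrt M\},$$ and let $\mathcal S^*_\nu=\{(\alpha\bar w,\alpha^{-1}\bar x):1/\nu\le|\alpha|\le\nu\}$. Write $\partial f$ for the Fréchet subdifferential, $\operatorname{dist}$ for Euclidean distance in $\mathbb R^{d_1}\times\mathbb R^{d_2}$, and $z_k=(w_k,x_k)$. The three methods are: * *Polyak subgradient*: choose any $\zeta_k\in\partial f(z_k)$; if $\zeta_k=0$, exit (subsequent iterates are taken to equal $z_k$); otherwise $z_{k+1}=\operatorname{proj}_{\mathcal S_\nu}\big(z_k-\frac{f(z_k)-\min_{\mathcal S_\nu}f}{\|\zeta_k\|^2}\zeta_k\big)$. * *Geometric subgradient* with parameters $\lambda,q$: choose any $\zeta_k\in\partial f(z_k)$; if $\zeta_k=0$, exit (same convention); otherwise $z_{k+1}=\operatorname{proj}_{\mathcal S_\nu}\big(z_k-\lambda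 q^k\zeta_k/\|\zeta_k\|\big)$. * *Prox-linear* with parameter $\beta$: $z_{k+1}$ minimizes $h(F(z_k)+\nabla F(z_k)(z-z_k))+\frac\beta2\|z-z_k\|^2$ over $z\in\mathcal S_\nu$, where $F(w,x)=(\langle\ell_i,w\rangle\langle r_i,x\rangle-y_i)_{i=1}^m$ and $h(v)=\frac1m\|v\|_1$. **Statement.** For all $\eta,\mu_0,p_0>0$ there are constants $c_1,c_2,c_3,c_5,c_6>0$, depending only on $\mu_0,p_0,\eta$, such that in the setting above, whenever $$m\ \ge\ \frac{c_1(d_1+d_2+1)}{(1-2p_{\rm fail})^2}\ln\Big(c_2+\frac{c_2}{1-2p_{\rm fail}}\Big),$$ there is an event of probability at least $1-4\exp(-c_3(1-2p_{\rm fail})^2m)$ on which the set of minimizers of $f$ over $\mathcal S_\nu$ equals $\mathcal S^*_\nu$, and, for every initial point $z_0=(w_0,x_0)$ with $$\frac{\operatorname{dist}(z_0,\mathcal S^*_\nu)}{\sqrt M}\le\frac{c_6(1-2p_{\rm fail})}{4\sqrt2\,c_5(\nu+1)},$$ the following hold. 1. If $z_0\in\mathcal S_\nu$, all iterates of the Polyak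 subgradient method started at $z_0$ satisfy $$\frac{\operatorname{dist}^2(z_k,\mathcal S^*_\nu)}{M}\le\Big(1-\frac{c_6^2(1-2p_{\rm fail})^2}{32c_5^2(\nu+1)^4}\Big)^k\cdot\frac{c_6^2(1-2p_{\rm fail})^2}{32c_5^2(\nu+1)^2}\qquad\forall k\ge0.$$ 2. If $z_0\in\mathcal S_\nu$, all iterates of the geometric subgradient method started at $z_0$ with $\lambda=\frac{c_6^2(1-2p_{\rm fail})^2\sqrt M}{16\sqrt2\,c_5^2\nu(\nu+1)^2}$ and $q=\sqrt{1-\frac{c_6^2(1-2p_{\rm fail})^2}{32c_5^2(\nu+1)^4}}$ satisfy the same bound as in 1. 3. All iterates of the prox-linear method with $\beta=c_5$ started at $z_0$ satisfy $$\frac{\operatorname{dist}(z_k,\mathcal S^*_\nu)}{\sqrt M}\le2^{-2^k}\cdot\frac{c_6(1-2p_{\rm fail})}{2\sqrt2\,c_5(\nu+1)}\qquad\forall k\ge0.$$ -/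

import Mathlib

open MeasureTheory ProbabilityTheory Filter Topology

noncomputable section

/-! ### Generalized differentiation, projections and the three algorithms -/

section Algorithms

variable {E : Type*} [NormedAddCommGroup E] [InnerProductSpace ℝ E]

/-- The Fréchet subdifferential of `f` at `x`: all `v` with
`f y ≥ f x + ⟪v, y - x⟫ + o(‖y - x‖)` as `y → x`. -/
def frechetSubdiff (f : E → ℝ) (x : E) : Set E :=
  {v | ∀ ε : ℝ, 0 < ε →
    ∀ᶠ y in 𝓝 x, f x + inner ℝ v (y - x) - ε * ‖y - x‖ ≤ f y}

/-- `p` is a nearest point of `Q` to `x`. -/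
def IsNearestPoint (Q : Set E) (x p : E) : Prop :=
  p ∈ Q ∧ ∀ q ∈ Q, ‖x - p‖ ≤ ‖x - q‖

/-- The set of minimizers of `f` over `Q`. -/
def argminSet (f : E → ℝ) (Q : Set E) : Set E :=
  {x | x ∈ Q ∧ IsMinOn f Q x}

/-- `z 0, z 1, …` is a sequence of iterates of the Polyak subgradient method for minimizing `f`
over `Q`: in each step an arbitrary subgradient `ζ` is chosen; if `ζ = 0` the method exits
(recorded by repeating the current point), otherwise
`z (k+1) = proj_Q (z k - (f (z k) - min_Q f) / ‖ζ‖² • ζ)`. -/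
def IsPolyakRun (f : E → ℝ) (Q : Set E) (z : ℕ → E) : Prop :=
  ∀ k, ∃ ζ ∈ frechetSubdiff f (z k),
    (ζ = 0 ∧ ∀ j, k ≤ j → z j = z k) ∨
    (ζ ≠ 0 ∧ IsNearestPoint Q (z k - ((f (z k) - sInf (f '' Q)) / ‖ζ‖ ^ 2) • ζ) (z (k + 1)))

/-- `z 0, z 1, …` is a sequence of iterates of the subgradient method with geometrically
decreasing step sizes `lam * q ^ k`: in each step an arbitrary subgradient `ζ` is chosen; if
`ζ = 0` the method exits (recorded by repeating the current point), otherwise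
`z (k+1) = proj_Q (z k - lam * q ^ k * ζ / ‖ζ‖)`. -/
def IsGeometricRun (f : E → ℝ) (Q : Set E) (lam q : ℝ) (z : ℕ → E) : Prop :=
  ∀ k, ∃ ζ ∈ frechetSubdiff f (z k),
    (ζ = 0 ∧ ∀ j, k ≤ j → z j = z k) ∨
    (ζ ≠ 0 ∧ IsNearestPoint Q (z k - (lam * q ^ k / ‖ζ‖) • ζ) (z (k + 1)))

/-- `z 0, z 1, …` is a sequence of iterates of the prox-linear method with proximal parameter `β`
for minimizing `h ∘ F` over `Q`: `z (k+1)` minimizes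
`u ↦ h (F (z k) + ∇F (z k) (u - z k)) + β / 2 * ‖u - z k‖²` over `Q`. -/
def IsProxLinearRun {m : ℕ} (h : (Fin m → ℝ) → ℝ) (F : E → Fin m → ℝ) (Q : Set E) (β : ℝ)
    (z : ℕ → E) : Prop :=
  ∀ k, z (k + 1) ∈ argminSet
    (fun u => h (F (z k) + fderiv ℝ F (z k) (u - z k)) + β / 2 * ‖u - z k‖ ^ 2) Q

end Algorithms

/-! ### The blind deconvolution problem -/

/-- The space `ℝ^{d₁} × ℝ^{d₂}` of pairs `(w, x)` with its Euclidean norm. -/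
abbrev PairSpace (d₁ d₂ : ℕ) : Type :=
  WithLp 2 (EuclideanSpace ℝ (Fin d₁) × EuclideanSpace ℝ (Fin d₂))

section Frobenius
open scoped Matrix.Norms.Frobenius

/-- The Frobenius norm of a real matrix. -/
def frobNorm {d₁ d₂ : ℕ} (X : Matrix (Fin d₁) (Fin d₂) ℝ) : ℝ := ‖X‖

end Frobenius

/-- `‖w xᵀ‖_F`. -/
def signalSize {d₁ d₂ : ℕ} (w : EuclideanSpace ℝ (Fin d₁)) (x : EuclideanSpace ℝ (Fin d₂)) : ℝ :=
  frobNorm (Matrix.vecMulVec (WithLp.ofLp w) (WithLp.ofLp x))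

/-- The residual map `(w, x) ↦ (⟪ℓ_i, w⟫ ⟪r_i, x⟫ - y_i)_{i = 1, …, m}`. -/
def bilinResidual {m d₁ d₂ : ℕ} (ℓ : Fin m → EuclideanSpace ℝ (Fin d₁))
    (r : Fin m → EuclideanSpace ℝ (Fin d₂)) (y : Fin m → ℝ) (z : PairSpace d₁ d₂) : Fin m → ℝ :=
  fun i => inner ℝ (ℓ i) z.fst * inner ℝ (r i) z.snd - y i

/-- The averaged `ℓ¹` norm `v ↦ (1/m) ∑ |v_i|`. -/
def meanAbs {m : ℕ} (v : Fin m → ℝ) : ℝ := (1 / (m : ℝ)) * ∑ i, |v i|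

/-- The penalty `f(w, x) = (1/m) ∑ |⟪ℓ_i, w⟫ ⟪r_i, x⟫ - y_i|`. -/
def penalty {m d₁ d₂ : ℕ} (ℓ : Fin m → EuclideanSpace ℝ (Fin d₁))
    (r : Fin m → EuclideanSpace ℝ (Fin d₂)) (y : Fin m → ℝ) (z : PairSpace d₁ d₂) : ℝ :=
  meanAbs (bilinResidual ℓ r y z)

/-- The feasible region `S_ν`: both factors have norm at most `ν √M`, `M = ‖w̄ x̄ᵀ‖_F`. -/
def feasibleSet {d₁ d₂ : ℕ} (ν : ℝ) (wbar : EuclideanSpace ℝ (Fin d₁))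
    (xbar : EuclideanSpace ℝ (Fin d₂)) : Set (PairSpace d₁ d₂) :=
  {z | ‖z.fst‖ ≤ ν * √(signalSize wbar xbar) ∧ ‖z.snd‖ ≤ ν * √(signalSize wbar xbar)}

/-- The solution set `S*_ν = {(α w̄, (1/α) x̄) : 1/ν ≤ |α| ≤ ν}`. -/
def solutionSet {d₁ d₂ : ℕ} (ν : ℝ) (wbar : EuclideanSpace ℝ (Fin d₁))
    (xbar : EuclideanSpace ℝ (Fin d₂)) : Set (PairSpace d₁ d₂) :=
  {z | ∃ α : ℝ, 1 / ν ≤ |α| ∧ |α| ≤ ν ∧ z = WithLp.toLp 2 (α • wbar, (1 / α) • xbar)}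

/-- The corrupted measurements: exact for `i ∉ Iout`, and `ξ_i` for `i ∈ Iout`. -/
def measurements {m d₁ d₂ : ℕ} (ℓ : Fin m → EuclideanSpace ℝ (Fin d₁))
    (r : Fin m → EuclideanSpace ℝ (Fin d₂)) (wbar : EuclideanSpace ℝ (Fin d₁))
    (xbar : EuclideanSpace ℝ (Fin d₂)) (Iout : Finset (Fin m)) (ξ : Fin m → ℝ) : Fin m → ℝ :=
  fun i => if i ∈ Iout then ξ i else inner ℝ (ℓ i) wbar * inner ℝ (r i) xbar

/-! ### The random measurement model -/

/-- The law `D` is that of an `η`-sub-gaussian random vector: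
`𝔼 exp (⟪u, X⟫² / η²) ≤ 2` for all unit vectors `u`. -/
def IsSubGaussianLaw {d : ℕ} (η : ℝ) (D : Measure (EuclideanSpace ℝ (Fin d))) : Prop :=
  ∀ u : EuclideanSpace ℝ (Fin d), ‖u‖ = 1 →
    ∫⁻ a, ENNReal.ofReal (Real.exp ((inner ℝ u a) ^ 2 / η ^ 2)) ∂D ≤ 2

/-- The pairs `(ℓ_i, r_i)` are i.i.d. copies of `(ℓ, r)`, where `ℓ` and `r` are independent
`η`-sub-gaussian random vectors with laws `Dl` and `Dr`, and `ℙ(|ℓᵀ X r| ≥ μ₀) ≥ p₀` for every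
matrix `X` of rank at most two and unit Frobenius norm. -/
structure IsSubGaussianModel {Ω : Type*} [MeasurableSpace Ω] (P : Measure Ω) {m d₁ d₂ : ℕ}
    (ℓ : Fin m → Ω → EuclideanSpace ℝ (Fin d₁)) (r : Fin m → Ω → EuclideanSpace ℝ (Fin d₂))
    (Dl : Measure (EuclideanSpace ℝ (Fin d₁))) (Dr : Measure (EuclideanSpace ℝ (Fin d₂)))
    (η μ₀ p₀ : ℝ) : Prop where
  isProb_left : IsProbabilityMeasure Dl
  isProb_right : IsProbabilityMeasure Dr
  law : ∀ i, HasLaw (fun ω => (ℓ i ω, r i ω)) (Dl.prod Dr) P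
  indep : iIndepFun (fun i ω => (ℓ i ω, r i ω)) P
  subGaussian_left : IsSubGaussianLaw η Dl
  subGaussian_right : IsSubGaussianLaw η Dr
  nondegenerate : ∀ X : Matrix (Fin d₁) (Fin d₂) ℝ, X.rank ≤ 2 → frobNorm X = 1 →
    p₀ ≤ (Dl.prod Dr).real
      {a | μ₀ ≤ |dotProduct (WithLp.ofLp a.1) (X.mulVec (WithLp.ofLp a.2))|}

end

/-!
The randomness enters only through two deterministic properties of the sampled vectors, collected
in `IsWellConditioned`: with `Δ = 1 - 2 p_fail`, the averages of `|⟪ℓ_i, u⟫ ⟪r_i, v⟫|` are at most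
`K ‖u‖ ‖v‖`, and on every matrix `A` of rank at most two the average of `|ℓ_iᵀ A r_i|`, taken with
a minus sign on the outliers, is at least a multiple of `Δ ‖A‖_F`.

These properties give everything else. The second one bounds the penalty gap below by
`c₆ Δ ‖w xᵀ - w̄ x̄ᵀ‖_F`, since a corrupted measurement changes the gap by at most what it would
contribute itself. On the feasible region that Frobenius norm controls the distance to the solution
set (`exists_scaling`): after normalizing `‖w̄‖ = ‖x̄‖ = 1`, and if `w` is the longer factor, the
scaling `α` is the component of `w` along `w̄` when the gap is small and that component is at least
one in absolute value, and `±1` otherwise. So the penalty is sharp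
(`IsWellConditioned.isSharpWeaklyConvex`). The first property bounds the error of linearizing the
residual by `K / 2 ‖u - z‖²`, which is weak convexity, and bounds the subgradients on the feasible
region. A Fréchet subgradient is a subgradient of the convex linearized model
(`frechetSubdiff.le_of_convex_model`), so the usual one-step estimates apply within the tube
`dist ≤ μ / (2 ρ)`, and yield the three rates (`IsSharpWeaklyConvex.polyak`,
`IsSharpWeaklyConvex.geometric`, `IsSharpWeaklyConvex.proxLinear`). A zero subgradient inside the
tube forces the iterate to be a solution already.

For the probability estimate, the first property follows by Cauchy–Schwarz from bounds on the
empirical second moments of the `ℓ_i` and the `r_i`, which a Chernoff bound gives on a `1/2`-net of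
the unit ball and a norm argument extends to all directions. For the second, a matrix of rank at
most two is written as `e₁ pᵀ + e₂ qᵀ` with orthonormal `e₁, e₂`, so that unit Frobenius norm means
`‖p‖² + ‖q‖² = 1`. For fixed factors `|ℓᵀ A r|` is nonnegative and sub-exponential, with mean at
least `μ₀ p₀ ‖A‖_F`, and its signed sum, whose mean is `Δ m` times as large, concentrates
(`measureReal_signed_sum_le`). Nets of mesh proportional to `Δ` transfer this to all matrices
(`isWellConditioned_of_net`), the first property absorbing the discretization error; their size
accounts for the logarithm in the sample size requirement. The exceptional events never involve the
corruptions `ξ_i`, which are therefore arbitrary and need not be measurable.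
-/

/-! ### Sharpness of the rank-one factorization -/

/-- The case `1 / 2 ≤ a ≤ 1` of `exists_scaling_core`, in which no rescaling is needed. -/
lemma unscaled_sq_dist_le {a b p s : ℝ} (ha : 1 / 2 ≤ a) (ha1 : a ≤ 1) (hab : 1 / 2 < a * b)
    (hp1 : p * (s + b ^ 2) ≤ 1 / 4) (hp : 0 ≤ p) (hs : 0 ≤ s) (hx : s + b ^ 2 ≤ p + a ^ 2) :
    (p + (a - 1) ^ 2) + (s + (b - 1) ^ 2) ≤
      4 * ((a * b - 1) ^ 2 + a ^ 2 * s + b ^ 2 * p + p * s) := by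
  have hb0 : 0 < b := by
    by_contra! hb
    nlinarith
  have quarter : ∀ t : ℝ, 1 / 2 ≤ t → 1 ≤ 4 * t ^ 2 := fun t ht => by nlinarith
  have hs4 : s ≤ 4 * (a ^ 2 * s) := by
    have := mul_le_mul_of_nonneg_right (quarter a ha) hs
    linarith
  have hps : 0 ≤ p * s := by positivity
  have hbp : 0 ≤ b ^ 2 * p := by positivity
  rcases le_or_gt b 1 with hb | hb
  · have hbh : 1 / 2 ≤ b := hab.le.trans (mul_le_of_le_one_left hb0.le ha1)
    have hp4 : p ≤ 4 * (b ^ 2 * p) := by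
      have := mul_le_mul_of_nonneg_right (quarter b hbh) hp
      linarith
    have ab_a : a * b ≤ a := mul_le_of_le_one_right (by linarith) hb
    have ab_b : a * b ≤ b := mul_le_of_le_one_left hb0.le ha1
    have h6 : (a - 1) ^ 2 ≤ (a * b - 1) ^ 2 := by
      rw [← neg_sq (a - 1), ← neg_sq (a * b - 1)]
      apply pow_le_pow_left₀ <;> linarith
    have h7 : (b - 1) ^ 2 ≤ (a * b - 1) ^ 2 := by
      rw [← neg_sq (b - 1), ← neg_sq (a * b - 1)]
      apply pow_le_pow_left₀ <;> linarith
    linarith [sq_nonneg (a * b - 1)]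
  · have hb2 : 1 ≤ b ^ 2 := one_le_pow₀ hb.le
    have hpb : p ≤ b ^ 2 * p := le_mul_of_one_le_left hp hb2
    have hp4 : p ≤ 1 / 4 := by linarith
    -- Here `b² ≤ p + a²`, so the orthogonal part `p` controls the gap between `a ≤ 1 < b`.
    have h8 : b - a ≤ p := by nlinarith
    have h9 : (b - a) ^ 2 ≤ p := by nlinarith
    have h6 : (a - 1) ^ 2 ≤ (b - a) ^ 2 := by apply sq_le_sq' <;> linarith
    have h7 : (b - 1) ^ 2 ≤ (b - a) ^ 2 := by apply sq_le_sq' <;> linarith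
    linarith [sq_nonneg (a * b - 1)]

/-- The scalar form of sharpness when the first factor is the longer one. For `‖wb‖ = ‖xb‖ = 1`,
`a` and `b` are the components of `w` and `x` along `wb` and `xb`, and `p` and `s` the squared norms
of the orthogonal remainders; the last factor on the right is `‖w xᵀ - wb xbᵀ‖_F²`. -/
lemma exists_scaling_core {a b p s ν : ℝ} (hν : 1 ≤ ν) (ha : 0 ≤ a) (hp : 0 ≤ p) (hs : 0 ≤ s)
    (hw : p + a ^ 2 ≤ ν ^ 2) (hx : s + b ^ 2 ≤ p + a ^ 2) :
    ∃ α : ℝ, 1 / ν ≤ |α| ∧ |α| ≤ ν ∧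
      (p + (a - α) ^ 2) + (s + (b - 1 / α) ^ 2) ≤
        8 * (ν + 1) ^ 2 * ((a * b - 1) ^ 2 + a ^ 2 * s + b ^ 2 * p + p * s) := by
  set D := (a * b - 1) ^ 2 + a ^ 2 * s + b ^ 2 * p + p * s with hD
  have hν0 : 0 < ν := by linarith
  have h1ν : 1 / ν ≤ 1 := by rw [div_le_one hν0]; exact hν
  have haν : a ≤ ν := by nlinarith
  have has : 0 ≤ a ^ 2 * s := by positivity
  have hbp : 0 ≤ b ^ 2 * p := by positivity
  have hps : 0 ≤ p * s := by positivity
  have hD0 : 0 ≤ D := by positivity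
  rcases le_or_gt (1 / 4) D with h | h
  -- If the gap is not small, the trivial bound on the distance to `(wb, xb)` is enough.
  · refine ⟨1, by simpa using h1ν, by simpa using hν, ?_⟩
    have hb : -ν ≤ b := by
      have : b ^ 2 ≤ ν ^ 2 := by linarith
      exact (abs_le_of_sq_le_sq' this hν0.le).1
    have h2 : 2 * (ν + 1) ^ 2 ≤ 8 * (ν + 1) ^ 2 * D := by nlinarith [sq_nonneg (ν + 1)]
    nlinarith
  · have hab : 1 / 2 < a * b := by nlinarith
    have ha0 : 0 < a := by
      rcases ha.eq_or_lt with h0 | h0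
      · rw [← h0] at hab; norm_num at hab
      · exact h0
    have hb0 : 0 < b := by
      by_contra! hb; nlinarith
    have h14 : 1 / 4 < (a * b) ^ 2 := by nlinarith
    have hp1 : p * (s + b ^ 2) < 1 / 4 := by nlinarith [sq_nonneg (a * b - 1)]
    have hah : 1 / 2 ≤ a := by
      by_contra! hlt
      have h3 : 1 / 4 < a ^ 2 * (s + b ^ 2) := by nlinarith
      have h4 : p < a ^ 2 := by
        by_contra! h5
        have : a ^ 2 * (s + b ^ 2) ≤ p * (s + b ^ 2) :=
          mul_le_mul_of_nonneg_right h5 (by positivity)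
        linarith
      have h5 : a ^ 2 < 1 / 4 := by nlinarith
      nlinarith
    have hν1 : D ≤ (ν + 1) ^ 2 * D := by nlinarith
    rcases le_or_gt 1 a with h1 | h1
    · have ha2 : 1 ≤ a ^ 2 := one_le_pow₀ h1
      refine ⟨a, by rw [abs_of_pos ha0]; linarith, by rw [abs_of_pos ha0]; exact haν, ?_⟩
      have e1 : (b - 1 / a) ^ 2 ≤ (a * b - 1) ^ 2 := by
        have : a * b - 1 = a * (b - 1 / a) := by field_simp
        rw [this, mul_pow]
        exact le_mul_of_one_le_left (sq_nonneg _) ha2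
      have e2 : s ≤ a ^ 2 * s := le_mul_of_one_le_left hs ha2
      have e3 : 1 / 2 ≤ ν * b := hab.le.trans (mul_le_mul_of_nonneg_right haν hb0.le)
      have e4 : 1 / 4 ≤ (ν * b) ^ 2 := by
        have := pow_le_pow_left₀ (by norm_num) e3 2
        linarith
      have e5 : p ≤ 4 * ν ^ 2 * (b ^ 2 * p) := by
        have := mul_le_mul_of_nonneg_right e4 hp
        linarith
      have e6 : ν ^ 2 * (b ^ 2 * p) ≤ (ν + 1) ^ 2 * (b ^ 2 * p) := by
        apply mul_le_mul_of_nonneg_right _ hbp; nlinarith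
      have e7 : (ν + 1) ^ 2 * (b ^ 2 * p) ≤ (ν + 1) ^ 2 * D :=
        mul_le_mul_of_nonneg_left (by rw [hD]; nlinarith [sq_nonneg (a * b - 1)]) (by positivity)
      have e8 : (a - a) ^ 2 = 0 := by ring
      have e9 : s + (b - 1 / a) ^ 2 ≤ D := by rw [hD]; linarith
      linarith
    · refine ⟨1, by simpa using h1ν, by simpa using hν, ?_⟩
      have key := unscaled_sq_dist_le hah h1.le hab (by linarith : p * (s + b ^ 2) ≤ 1 / 4) hp hs hx
      rw [div_one]
      linarith

/-- Exchanging the two factors replaces `α` by `1 / α`, so neither has to be the longer one. -/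
lemma exists_scaling_real {a b p s ν : ℝ} (hν : 1 ≤ ν) (hp : 0 ≤ p) (hs : 0 ≤ s)
    (hw : p + a ^ 2 ≤ ν ^ 2) (hx : s + b ^ 2 ≤ ν ^ 2) :
    ∃ α : ℝ, 1 / ν ≤ |α| ∧ |α| ≤ ν ∧
      (p + (a - α) ^ 2) + (s + (b - 1 / α) ^ 2) ≤
        8 * (ν + 1) ^ 2 * ((a * b - 1) ^ 2 + a ^ 2 * s + b ^ 2 * p + p * s) := by
  have signed : ∀ a b p s : ℝ, 0 ≤ p → 0 ≤ s → p + a ^ 2 ≤ ν ^ 2 → s + b ^ 2 ≤ p + a ^ 2 →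
      ∃ α : ℝ, 1 / ν ≤ |α| ∧ |α| ≤ ν ∧
      (p + (a - α) ^ 2) + (s + (b - 1 / α) ^ 2) ≤
        8 * (ν + 1) ^ 2 * ((a * b - 1) ^ 2 + a ^ 2 * s + b ^ 2 * p + p * s) := by
    intro a b p s hp hs hw hx
    rcases le_total 0 a with ha | ha
    · exact exists_scaling_core hν ha hp hs hw hx
    · obtain ⟨α, h1, h2, h3⟩ := exists_scaling_core (a := -a) (b := -b) hν (by linarith) hp hs
        (by simpa using hw) (by simpa using hx)
      refine ⟨-α, by simpa using h1, by simpa using h2, ?_⟩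
      calc _ = (p + (-a - α) ^ 2) + (s + (-b - 1 / α) ^ 2) := by
            rw [one_div, one_div, inv_neg]; ring
        _ ≤ _ := h3
        _ = _ := by ring
  rcases le_total (s + b ^ 2) (p + a ^ 2) with h | h
  · exact signed a b p s hp hs hw h
  · obtain ⟨α, h1, h2, h3⟩ := signed b a s p hs hp hx h
    have hν0 : 0 < ν := by linarith
    have hα : 0 < |α| := lt_of_lt_of_le (by positivity) h1
    refine ⟨1 / α, ?_, ?_, ?_⟩
    · rw [abs_div, abs_one]; exact one_div_le_one_div_of_le hα h2
    · rw [abs_div, abs_one]; exact (one_div_le hν0 hα).1 h1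
    · rw [one_div_one_div]
      calc _ = s + (b - α) ^ 2 + (p + (a - 1 / α) ^ 2) := by ring
        _ ≤ _ := h3
        _ = _ := by ring

section Sharp

variable {W X : Type*} [NormedAddCommGroup W] [InnerProductSpace ℝ W]
  [NormedAddCommGroup X] [InnerProductSpace ℝ X]

/-- Sharpness: the squared distance of `(w, x)` to a suitable rescaling of `(wb, xb)` is controlled
by the squared Frobenius norm of `w xᵀ - wb xbᵀ`, written out on the right-hand side. -/
lemma exists_scaling {wb w : W} {xb x : X} {ν M : ℝ} (hν : 1 ≤ ν) (hM : 0 < M)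
    (hwb : ‖wb‖ ^ 2 = M) (hxb : ‖xb‖ ^ 2 = M) (hw : ‖w‖ ≤ ν * √M) (hx : ‖x‖ ≤ ν * √M) :
    ∃ α : ℝ, 1 / ν ≤ |α| ∧ |α| ≤ ν ∧
      M * (‖w - α • wb‖ ^ 2 + ‖x - (1 / α) • xb‖ ^ 2) ≤
        8 * (ν + 1) ^ 2 *
          (‖w‖ ^ 2 * ‖x‖ ^ 2 - 2 * (inner ℝ w wb * inner ℝ x xb) + M ^ 2) := by
  have hν0 : 0 ≤ ν := by linarith
  have sq_le : ∀ t : ℝ, 0 ≤ t → t ≤ ν * √M → t ^ 2 / M ≤ ν ^ 2 := by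
    intro t h0 ht
    rw [div_le_iff₀ hM]
    calc t ^ 2 ≤ (ν * √M) ^ 2 := pow_le_pow_left₀ h0 ht 2
      _ = ν ^ 2 * M := by rw [mul_pow, Real.sq_sqrt hM.le]
  have cw : (inner ℝ w wb / M) ^ 2 ≤ ‖w‖ ^ 2 / M := by
    rw [div_pow, div_le_div_iff₀ (by positivity) hM]
    have := real_inner_mul_inner_self_le w wb
    rw [real_inner_self_eq_norm_sq, real_inner_self_eq_norm_sq, hwb] at this
    nlinarith
  have cx : (inner ℝ x xb / M) ^ 2 ≤ ‖x‖ ^ 2 / M := by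
    rw [div_pow, div_le_div_iff₀ (by positivity) hM]
    have := real_inner_mul_inner_self_le x xb
    rw [real_inner_self_eq_norm_sq, real_inner_self_eq_norm_sq, hxb] at this
    nlinarith
  obtain ⟨α, h1, h2, h3⟩ := exists_scaling_real (a := inner ℝ w wb / M) (b := inner ℝ x xb / M)
    (p := ‖w‖ ^ 2 / M - (inner ℝ w wb / M) ^ 2) (s := ‖x‖ ^ 2 / M - (inner ℝ x xb / M) ^ 2) hν
    (by linarith) (by linarith) (by simpa using sq_le _ (norm_nonneg w) hw)
    (by simpa using sq_le _ (norm_nonneg x) hx)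
  refine ⟨α, h1, h2, ?_⟩
  have h4 := mul_le_mul_of_nonneg_left h3 (sq_nonneg M)
  rw [norm_sub_sq_real w, norm_sub_sq_real x, inner_smul_right, norm_smul, mul_pow, hwb,
    inner_smul_right, norm_smul, mul_pow, hxb, Real.norm_eq_abs, sq_abs, Real.norm_eq_abs, sq_abs]
  calc _ = M ^ 2 * (‖w‖ ^ 2 / M - (inner ℝ w wb / M) ^ 2 + (inner ℝ w wb / M - α) ^ 2 +
      (‖x‖ ^ 2 / M - (inner ℝ x xb / M) ^ 2 + (inner ℝ x xb / M - 1 / α) ^ 2)) := by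
        field_simp; ring
    _ ≤ _ := h4
    _ = _ := by field_simp; ring

end Sharp

/-! ### Local convergence for sharp weakly convex problems -/

section Convergence

variable {E : Type*} [NormedAddCommGroup E] [InnerProductSpace ℝ E]

lemma IsNearestPoint.norm_sub_le {Q : Set E} (hQ : Convex ℝ Q) {x p q : E}
    (h : IsNearestPoint Q x p) (hq : q ∈ Q) : ‖p - q‖ ≤ ‖x - q‖ := by
  obtain ⟨hp, hmin⟩ := h
  have hinf : ‖x - p‖ = ⨅ w : Q, ‖x - w‖ := by
    have : Nonempty Q := ⟨⟨p, hp⟩⟩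
    refine le_antisymm (le_ciInf fun w => hmin w w.2) ?_
    exact ciInf_le (f := fun w : Q => ‖x - w‖)
      ⟨0, by rintro _ ⟨w, rfl⟩; exact norm_nonneg _⟩ ⟨p, hp⟩
  have hvar := (norm_eq_iInf_iff_real_inner_le_zero hQ hp).1 hinf q hq
  have e : x - q = (x - p) - (q - p) := by abel
  have : ‖p - q‖ ^ 2 ≤ ‖x - q‖ ^ 2 := by
    rw [e, norm_sub_rev p q, norm_sub_sq_real (x - p)]
    nlinarith [sq_nonneg ‖x - p‖]
  exact le_of_sq_le_sq this (norm_nonneg _)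

/-- A Fréchet subgradient of a function that is majorized near `x`, up to a quadratic error, by a
convex model agreeing with it at `x` is a subgradient of the model. -/
lemma frechetSubdiff.le_of_convex_model {f ψ : E → ℝ} {x v : E} {ρ : ℝ}
    (hψ : ConvexOn ℝ Set.univ ψ) (hx : ψ x = f x)
    (hmaj : ∀ y, f y ≤ ψ y + ρ / 2 * ‖y - x‖ ^ 2) (hv : v ∈ frechetSubdiff f x) (y : E) :
    f x + inner ℝ v (y - x) ≤ ψ y := by
  have hstep : ∀ ε : ℝ, 0 < ε → inner ℝ v (y - x) - ε * ‖y - x‖ ≤ ψ y - ψ x := by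
    intro ε hε
    have hcurve : Tendsto (fun t : ℝ => x + t • (y - x)) (𝓝[>] 0) (𝓝 x) := by
      have : Continuous fun t : ℝ => x + t • (y - x) := by fun_prop
      simpa using (this.tendsto 0).mono_left nhdsWithin_le_nhds
    have hlim : Tendsto (fun t : ℝ => ψ y - ψ x + ρ / 2 * t * ‖y - x‖ ^ 2) (𝓝[>] 0)
        (𝓝 (ψ y - ψ x)) := by
      have : Continuous fun t : ℝ => ψ y - ψ x + ρ / 2 * t * ‖y - x‖ ^ 2 := by fun_prop
      simpa using (this.tendsto 0).mono_left nhdsWithin_le_nhds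
    refine ge_of_tendsto hlim ?_
    filter_upwards [hcurve.eventually (hv ε hε), Ioo_mem_nhdsGT (zero_lt_one' ℝ)] with t ht ht01
    obtain ⟨ht0, ht1⟩ := ht01
    have hconv := hψ.2 (Set.mem_univ x) (Set.mem_univ y) (by linarith : 0 ≤ 1 - t) ht0.le
      (by ring)
    have e : (1 - t) • x + t • y = x + t • (y - x) := by
      rw [smul_sub, sub_smul, one_smul]; abel
    rw [e, smul_eq_mul, smul_eq_mul] at hconv
    have hm := hmaj (x + t • (y - x))
    rw [add_sub_cancel_left, inner_smul_right, norm_smul, Real.norm_of_nonneg ht0.le] at ht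
    rw [add_sub_cancel_left, norm_smul, Real.norm_of_nonneg ht0.le] at hm
    have : t * (inner ℝ v (y - x) - ε * ‖y - x‖) ≤
        t * (ψ y - ψ x + ρ / 2 * t * ‖y - x‖ ^ 2) := by
      rw [hx] at hconv ⊢
      nlinarith
    exact le_of_mul_le_mul_left this ht0
  have hlim : Tendsto (fun ε : ℝ => inner ℝ v (y - x) - ε * ‖y - x‖) (𝓝[>] 0)
      (𝓝 (inner ℝ v (y - x))) := by
    have : Continuous fun ε : ℝ => inner ℝ v (y - x) - ε * ‖y - x‖ := by fun_prop
    simpa using (this.tendsto 0).mono_left nhdsWithin_le_nhds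
  have := le_of_tendsto hlim (eventually_mem_nhdsWithin.mono fun ε hε => hstep ε hε)
  linarith

/-- The data of the local convergence analysis: `f` has the minimal value `fstar` over the convex
set `Q`, attained on the compact set `S`, grows at least `μ` times as fast as the distance to `S`,
and at points of `Q` its Fréchet subgradients are at most `L` long and satisfy the subgradient
inequality of a `ρ`-weakly convex function. -/
structure IsSharpWeaklyConvex (f : E → ℝ) (Q S : Set E) (fstar μ ρ L : ℝ) : Prop where
  convex : Convex ℝ Q
  compact : IsCompact S
  nonempty : S.Nonempty
  subset : S ⊆ Q
  eq_min : ∀ s ∈ S, f s = fstar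
  sharp : ∀ z ∈ Q, μ * Metric.infDist z S ≤ f z - fstar
  subgradient : ∀ z ∈ Q, ∀ ζ ∈ frechetSubdiff f z, ∀ y,
    f z + inner ℝ ζ (y - z) - ρ / 2 * ‖y - z‖ ^ 2 ≤ f y
  norm_le : ∀ z ∈ Q, ∀ ζ ∈ frechetSubdiff f z, ‖ζ‖ ≤ L
  sharp_pos : 0 < μ
  weak_pos : 0 < ρ

namespace IsSharpWeaklyConvex

variable {f : E → ℝ} {Q S : Set E} {fstar μ ρ L : ℝ}

lemma isLeast (h : IsSharpWeaklyConvex f Q S fstar μ ρ L) : IsLeast (f '' Q) fstar := by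
  obtain ⟨s, hs⟩ := h.nonempty
  refine ⟨⟨s, h.subset hs, h.eq_min s hs⟩, ?_⟩
  rintro _ ⟨z, hz, rfl⟩
  have := h.sharp z hz
  have := mul_nonneg h.sharp_pos.le (Metric.infDist_nonneg (x := z) (s := S))
  linarith

lemma argminSet_eq (h : IsSharpWeaklyConvex f Q S fstar μ ρ L) : argminSet f Q = S := by
  ext z
  constructor
  · rintro ⟨hz, hmin⟩
    obtain ⟨s, hs⟩ := h.nonempty
    have h1 : f z ≤ f s := hmin (h.subset hs)
    have h2 := h.sharp z hz
    rw [h.eq_min s hs] at h1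
    have h3 : Metric.infDist z S ≤ 0 := by
      by_contra! h4
      have := mul_pos h.sharp_pos h4
      linarith
    exact (h.compact.isClosed.mem_iff_infDist_zero h.nonempty).2
      (le_antisymm h3 Metric.infDist_nonneg)
  · intro hz
    refine ⟨h.subset hz, fun y hy => ?_⟩
    change f z ≤ f y
    rw [h.eq_min z hz]
    exact h.isLeast.2 ⟨y, hy, rfl⟩

/-- One projected subgradient step. -/
lemma infDist_step_sq_le (h : IsSharpWeaklyConvex f Q S fstar μ ρ L) {z z' ζ : E} {t : ℝ}
    (hz : z ∈ Q) (hζ : ζ ∈ frechetSubdiff f z) (ht : 0 ≤ t)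
    (hz' : IsNearestPoint Q (z - t • ζ) z') :
    Metric.infDist z' S ^ 2 ≤ Metric.infDist z S ^ 2 +
      2 * t * (ρ / 2 * Metric.infDist z S ^ 2 - (f z - fstar)) + t ^ 2 * ‖ζ‖ ^ 2 := by
  obtain ⟨s, hs, hd⟩ := h.compact.exists_infDist_eq_dist h.nonempty z
  have h1 : Metric.infDist z' S ≤ ‖z - t • ζ - s‖ := by
    refine (Metric.infDist_le_dist_of_mem hs).trans ?_
    rw [dist_eq_norm]
    exact hz'.norm_sub_le h.convex (h.subset hs)
  have h2 := h.subgradient z hz ζ hζ s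
  rw [h.eq_min s hs] at h2
  rw [hd, dist_eq_norm]
  have h3 : Metric.infDist z' S ^ 2 ≤ ‖z - t • ζ - s‖ ^ 2 :=
    pow_le_pow_left₀ Metric.infDist_nonneg h1 2
  have e : z - t • ζ - s = (z - s) - t • ζ := by abel
  have e2 : s - z = -(z - s) := by abel
  rw [e, norm_sub_sq_real, inner_smul_right, real_inner_comm, norm_smul, mul_pow,
    Real.norm_eq_abs, sq_abs] at h3
  rw [e2, inner_neg_right, norm_neg] at h2
  nlinarith

/-- Near the solution set the method exits only at solutions. -/
lemma infDist_eq_zero_of_zero_mem (h : IsSharpWeaklyConvex f Q S fstar μ ρ L) {z : E}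
    (hz : z ∈ Q) (h0 : (0 : E) ∈ frechetSubdiff f z)
    (hd : Metric.infDist z S ≤ μ / (2 * ρ)) : Metric.infDist z S = 0 := by
  obtain ⟨s, hs, hds⟩ := h.compact.exists_infDist_eq_dist h.nonempty z
  have h2 := h.subgradient z hz 0 h0 s
  rw [h.eq_min s hs, inner_zero_left, norm_sub_rev, ← dist_eq_norm, ← hds] at h2
  have h3 := h.sharp z hz
  have hnn : 0 ≤ Metric.infDist z S := Metric.infDist_nonneg
  have h4 : ρ * Metric.infDist z S ≤ μ / 2 := by
    have := mul_le_mul_of_nonneg_left hd h.weak_pos.le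
    have e : ρ * (μ / (2 * ρ)) = μ / 2 := by
      have := h.weak_pos.ne'
      field_simp
    linarith
  by_contra hne
  have hpos : 0 < Metric.infDist z S := lt_of_le_of_ne hnn (Ne.symm hne)
  have := mul_pos h.sharp_pos hpos
  nlinarith

lemma weak_mul_sq_le (h : IsSharpWeaklyConvex f Q S fstar μ ρ L) {d : ℝ} (hd0 : 0 ≤ d)
    (hd : d ≤ μ / (2 * ρ)) : ρ * d ^ 2 ≤ μ * d / 2 := by
  have hρ := h.weak_pos
  have : ρ * d ≤ μ / 2 := by
    rw [le_div_iff₀ (by positivity)] at hd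
    linarith
  nlinarith

/-- Linear convergence of the Polyak method; the tube `R ≤ μ / (2 ρ)` is where half of the sharp
growth survives the weak convexity error. -/
theorem polyak (h : IsSharpWeaklyConvex f Q S fstar μ ρ L) {κ R : ℝ} (hκ1 : κ ≤ 1) (hκ0 : 0 ≤ κ)
    (hκ : 2 * L ^ 2 * κ ≤ μ ^ 2) {z : ℕ → E} (hz : IsPolyakRun f Q z) (h0 : z 0 ∈ Q)
    (hR : R ≤ μ / (2 * ρ)) (hd : Metric.infDist (z 0) S ≤ R) (k : ℕ) :
    Metric.infDist (z k) S ^ 2 ≤ (1 - κ) ^ k * R ^ 2 := by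
  have hR0 : 0 ≤ R := Metric.infDist_nonneg.trans hd
  suffices H : z k ∈ Q ∧ Metric.infDist (z k) S ^ 2 ≤ (1 - κ) ^ k * R ^ 2 from H.2
  induction k with
  | zero => exact ⟨h0, by simpa using pow_le_pow_left₀ Metric.infDist_nonneg hd 2⟩
  | succ k ih =>
    obtain ⟨hzk, hk⟩ := ih
    set d := Metric.infDist (z k) S with hd_def
    have hd0 : 0 ≤ d := Metric.infDist_nonneg
    have hdR : d ≤ μ / (2 * ρ) := by
      refine le_trans ?_ hR
      refine le_of_sq_le_sq (hk.trans ?_) hR0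
      exact mul_le_of_le_one_left (sq_nonneg R) (pow_le_one₀ (by linarith) (by linarith))
    obtain ⟨ζ, hζ, ⟨rfl, hstay⟩ | ⟨hne, hstep⟩⟩ := hz k
    · rw [hstay (k + 1) (Nat.le_succ k)]
      refine ⟨hzk, ?_⟩
      rw [h.infDist_eq_zero_of_zero_mem hzk hζ hdR]
      have : 0 ≤ 1 - κ := by linarith
      simp only [ne_eq, OfNat.ofNat_ne_zero, not_false_eq_true, zero_pow]
      positivity
    · refine ⟨hstep.1, ?_⟩
      rw [h.isLeast.csInf_eq] at hstep
      have hgap := h.sharp (z k) hzk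
      rw [← hd_def] at hgap
      set g := f (z k) - fstar with hg
      have hζ0 : 0 < ‖ζ‖ ^ 2 := by positivity
      have hg0 : 0 ≤ g := (mul_nonneg h.sharp_pos.le hd0).trans hgap
      have hs := h.infDist_step_sq_le hzk hζ (by positivity) hstep
      rw [← hd_def, ← hg] at hs
      have hw := h.weak_mul_sq_le hd0 hdR
      have hL : ‖ζ‖ ^ 2 ≤ L ^ 2 := pow_le_pow_left₀ (norm_nonneg _) (h.norm_le _ hzk _ hζ) 2
      have e : d ^ 2 + 2 * (g / ‖ζ‖ ^ 2) * (ρ / 2 * d ^ 2 - g) + (g / ‖ζ‖ ^ 2) ^ 2 * ‖ζ‖ ^ 2 =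
          d ^ 2 - g / ‖ζ‖ ^ 2 * (g - ρ * d ^ 2) := by
        field_simp; ring
      have hμd : 0 ≤ μ * d := mul_nonneg h.sharp_pos.le hd0
      have hprod : μ ^ 2 * d ^ 2 / 2 ≤ g * (g - ρ * d ^ 2) := by
        have : (μ * d) * (μ * d / 2) ≤ g * (g - ρ * d ^ 2) :=
          mul_le_mul hgap (by linarith) (by linarith) hg0
        linarith
      have hdec : κ * d ^ 2 ≤ g / ‖ζ‖ ^ 2 * (g - ρ * d ^ 2) := by
        rw [div_mul_eq_mul_div, le_div_iff₀ hζ0]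
        have h1 : κ * d ^ 2 * ‖ζ‖ ^ 2 ≤ κ * d ^ 2 * L ^ 2 :=
          mul_le_mul_of_nonneg_left hL (by positivity)
        have h2 := mul_le_mul_of_nonneg_right hκ (sq_nonneg d)
        linarith
      rw [e] at hs
      calc _ ≤ (1 - κ) * d ^ 2 := by linarith
        _ ≤ (1 - κ) * ((1 - κ) ^ k * R ^ 2) := mul_le_mul_of_nonneg_left hk (by linarith)
        _ = _ := by ring

/-- Linear convergence for geometrically decaying steps: the step lengths `τ R qᵏ` are `τ` times
the current bound on the distance. -/
theorem geometric (h : IsSharpWeaklyConvex f Q S fstar μ ρ L) {κ τ R q : ℝ} (hL : 0 < L)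
    (hτ : τ = μ / L) (hτ1 : τ ^ 2 ≤ 1 / 2) (hq0 : 0 ≤ q) (hq : q ^ 2 = 1 - κ) (hκ0 : 0 ≤ κ)
    (hκ : 2 * κ ≤ τ ^ 2) {z : ℕ → E} (hz : IsGeometricRun f Q (τ * R) q z) (h0 : z 0 ∈ Q)
    (hR : R ≤ μ / (2 * ρ)) (hd : Metric.infDist (z 0) S ≤ R) (k : ℕ) :
    Metric.infDist (z k) S ^ 2 ≤ (1 - κ) ^ k * R ^ 2 := by
  have hR0 : 0 ≤ R := Metric.infDist_nonneg.trans hd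
  have hτ0 : 0 < τ := by rw [hτ]; exact div_pos h.sharp_pos hL
  have hq1 : q ≤ 1 := by nlinarith
  suffices H : z k ∈ Q ∧ Metric.infDist (z k) S ≤ q ^ k * R by
    have := pow_le_pow_left₀ Metric.infDist_nonneg H.2 2
    rwa [mul_pow, ← pow_mul, mul_comm k 2, pow_mul, hq] at this
  induction k with
  | zero => exact ⟨h0, by simpa using hd⟩
  | succ k ih =>
    obtain ⟨hzk, hk⟩ := ih
    set d := Metric.infDist (z k) S with hd_def
    set D := q ^ k * R with hD
    have hD0 : 0 ≤ D := by positivity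
    have hd0 : 0 ≤ d := Metric.infDist_nonneg
    have hdR : d ≤ μ / (2 * ρ) := by
      refine le_trans (hk.trans ?_) hR
      exact mul_le_of_le_one_left hR0 (pow_le_one₀ hq0 hq1)
    have e1 : q ^ (k + 1) * R = q * D := by rw [hD]; ring
    rw [e1]
    obtain ⟨ζ, hζ, ⟨rfl, hstay⟩ | ⟨hne, hstep⟩⟩ := hz k
    · rw [hstay (k + 1) (Nat.le_succ k)]
      refine ⟨hzk, ?_⟩
      rw [h.infDist_eq_zero_of_zero_mem hzk hζ hdR]
      positivity
    · refine ⟨hstep.1, ?_⟩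
      have hζ0 : 0 < ‖ζ‖ := norm_pos_iff.2 hne
      have hζL := h.norm_le _ hzk _ hζ
      have hgap := h.sharp (z k) hzk
      rw [← hd_def] at hgap
      have hstep_size : τ * R * q ^ k / ‖ζ‖ = τ * D / ‖ζ‖ := by rw [hD]; ring
      rw [hstep_size] at hstep
      have hs := h.infDist_step_sq_le hzk hζ (by positivity) hstep
      rw [← hd_def] at hs
      have hw := h.weak_mul_sq_le hd0 hdR
      have e2 : (τ * D / ‖ζ‖) ^ 2 * ‖ζ‖ ^ 2 = τ ^ 2 * D ^ 2 := by field_simp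
      rw [e2] at hs
      have hneg : ρ / 2 * d ^ 2 - (f (z k) - fstar) ≤ -(3 / 4 * (μ * d)) := by linarith
      have hμ : μ = τ * L := by rw [hτ]; field_simp
      have hdec : 2 * (τ * D / ‖ζ‖) * (ρ / 2 * d ^ 2 - (f (z k) - fstar)) ≤
          -(3 / 2 * (τ ^ 2 * D * d)) := by
        have h1 : 2 * (τ * D / ‖ζ‖) * (ρ / 2 * d ^ 2 - (f (z k) - fstar)) ≤
            2 * (τ * D / ‖ζ‖) * -(3 / 4 * (μ * d)) :=
          mul_le_mul_of_nonneg_left hneg (by positivity)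
        have h2 : τ * d ≤ μ * d / ‖ζ‖ := by
          rw [le_div_iff₀ hζ0, hμ]
          have := mul_le_mul_of_nonneg_left hζL (mul_nonneg hτ0.le hd0)
          linarith
        have h3 := mul_le_mul_of_nonneg_left h2 (mul_nonneg hτ0.le hD0)
        have e3 : 2 * (τ * D / ‖ζ‖) * -(3 / 4 * (μ * d)) =
            -(3 / 2 * (τ * D * (μ * d / ‖ζ‖))) := by ring
        linarith
      -- The upper bound is a convex quadratic in `d`, so on `[0, D]` it is maximal at an endpoint.
      have hquad : d ^ 2 - 3 / 2 * (τ ^ 2 * D * d) ≤ (1 - 3 / 2 * τ ^ 2) * (D * d) := by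
        nlinarith
      have hend : (1 - 3 / 2 * τ ^ 2) * (D * d) ≤ (1 - 3 / 2 * τ ^ 2) * (D * D) :=
        mul_le_mul_of_nonneg_left (mul_le_mul_of_nonneg_left hk hD0) (by linarith)
      have hfin : Metric.infDist (z (k + 1)) S ^ 2 ≤ (q * D) ^ 2 := by
        rw [mul_pow, hq]
        have := mul_le_mul_of_nonneg_right hκ (sq_nonneg D)
        nlinarith
      exact le_of_sq_le_sq hfin (by positivity)

/-- Quadratic convergence of the prox-linear method for the model functions `ψ z`. -/
theorem proxLinear (h : IsSharpWeaklyConvex f Q S fstar μ ρ L) {ψ : E → E → ℝ}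
    (hψ : ∀ z y, |f y - ψ z y| ≤ ρ / 2 * ‖y - z‖ ^ 2) {z : ℕ → E}
    (hz : ∀ k, z (k + 1) ∈ argminSet (fun u => ψ (z k) u + ρ / 2 * ‖u - z k‖ ^ 2) Q)
    (hd : Metric.infDist (z 0) S ≤ μ / (2 * ρ)) (k : ℕ) :
    Metric.infDist (z k) S ≤ ((2 : ℝ) ^ (2 ^ k : ℕ))⁻¹ * (μ / ρ) := by
  have hρ := h.weak_pos
  have hμ := h.sharp_pos
  induction k with
  | zero =>
    refine hd.trans (le_of_eq ?_)
    simp only [pow_zero, pow_one]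
    field_simp
  | succ k ih =>
    obtain ⟨s, hs, hds⟩ := h.compact.exists_infDist_eq_dist h.nonempty (z k)
    obtain ⟨hmem, hmin⟩ := hz k
    have h1 : ψ (z k) (z (k + 1)) + ρ / 2 * ‖z (k + 1) - z k‖ ^ 2 ≤
        ψ (z k) s + ρ / 2 * ‖s - z k‖ ^ 2 := hmin (h.subset hs)
    have h2 := (abs_le.1 (hψ (z k) (z (k + 1)))).2
    have h3 := (abs_le.1 (hψ (z k) s)).1
    rw [h.eq_min s hs] at h3
    rw [norm_sub_rev s, ← dist_eq_norm (z k) s, ← hds] at h1 h3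
    have h4 := h.sharp _ hmem
    have h5 : μ * Metric.infDist (z (k + 1)) S ≤ ρ * Metric.infDist (z k) S ^ 2 := by linarith
    have h6 := pow_le_pow_left₀ Metric.infDist_nonneg ih 2
    have e : μ * (((2 : ℝ) ^ (2 ^ (k + 1) : ℕ))⁻¹ * (μ / ρ)) =
        ρ * (((2 : ℝ) ^ (2 ^ k : ℕ))⁻¹ * (μ / ρ)) ^ 2 := by
      rw [pow_succ 2 k, pow_mul]
      field_simp
    refine le_of_mul_le_mul_left ?_ hμ
    rw [e]
    exact h5.trans (mul_le_mul_of_nonneg_left h6 hρ.le)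

end IsSharpWeaklyConvex

end Convergence

/-! ### Frobenius norms of matrices of rank at most two -/

section FrobeniusRank
open scoped Matrix.Norms.Frobenius

variable {d₁ d₂ : ℕ}

/-- The matrix `a bᵀ + c dᵀ`. -/
noncomputable def pairMatrix (a : EuclideanSpace ℝ (Fin d₁)) (b : EuclideanSpace ℝ (Fin d₂))
    (c : EuclideanSpace ℝ (Fin d₁)) (d : EuclideanSpace ℝ (Fin d₂)) :
    Matrix (Fin d₁) (Fin d₂) ℝ :=
  Matrix.vecMulVec (WithLp.ofLp a) (WithLp.ofLp b) +
    Matrix.vecMulVec (WithLp.ofLp c) (WithLp.ofLp d)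

/-- The squared Frobenius norm of `a bᵀ + c dᵀ` in terms of norms and inner products. -/
noncomputable def pairNormSq {W X : Type*} [NormedAddCommGroup W] [InnerProductSpace ℝ W]
    [NormedAddCommGroup X] [InnerProductSpace ℝ X] (a : W) (b : X) (c : W) (d : X) : ℝ :=
  ‖a‖ ^ 2 * ‖b‖ ^ 2 + ‖c‖ ^ 2 * ‖d‖ ^ 2 + 2 * (inner ℝ a c * inner ℝ b d)

lemma frobNorm_sq (A : Matrix (Fin d₁) (Fin d₂) ℝ) : frobNorm A ^ 2 = ∑ i, ∑ j, A i j ^ 2 := by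
  rw [frobNorm, Matrix.frobenius_norm_def, ← Real.sqrt_eq_rpow, Real.sq_sqrt (by positivity)]
  simp

lemma frobNorm_nonneg (A : Matrix (Fin d₁) (Fin d₂) ℝ) : 0 ≤ frobNorm A := norm_nonneg A

lemma frobNorm_pairMatrix_sq (a : EuclideanSpace ℝ (Fin d₁)) (b : EuclideanSpace ℝ (Fin d₂))
    (c : EuclideanSpace ℝ (Fin d₁)) (d : EuclideanSpace ℝ (Fin d₂)) :
    frobNorm (pairMatrix a b c d) ^ 2 = pairNormSq a b c d := by
  rw [frobNorm_sq, pairNormSq, EuclideanSpace.real_norm_sq_eq, EuclideanSpace.real_norm_sq_eq,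
    EuclideanSpace.real_norm_sq_eq, EuclideanSpace.real_norm_sq_eq, PiLp.inner_apply,
    PiLp.inner_apply, Finset.sum_mul_sum, Finset.sum_mul_sum, Finset.sum_mul_sum, Finset.mul_sum,
    ← Finset.sum_add_distrib, ← Finset.sum_add_distrib]
  refine Finset.sum_congr rfl fun i _ => ?_
  rw [Finset.mul_sum, ← Finset.sum_add_distrib, ← Finset.sum_add_distrib]
  refine Finset.sum_congr rfl fun j _ => ?_
  simp only [pairMatrix, Matrix.add_apply, Matrix.vecMulVec_apply, RCLike.inner_apply, conj_trivial]
  ring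

lemma pairNormSq_nonneg (a : EuclideanSpace ℝ (Fin d₁)) (b : EuclideanSpace ℝ (Fin d₂))
    (c : EuclideanSpace ℝ (Fin d₁)) (d : EuclideanSpace ℝ (Fin d₂)) : 0 ≤ pairNormSq a b c d := by
  rw [← frobNorm_pairMatrix_sq]; positivity

lemma frobNorm_pairMatrix (a : EuclideanSpace ℝ (Fin d₁)) (b : EuclideanSpace ℝ (Fin d₂))
    (c : EuclideanSpace ℝ (Fin d₁)) (d : EuclideanSpace ℝ (Fin d₂)) :
    frobNorm (pairMatrix a b c d) = √(pairNormSq a b c d) := by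
  rw [← frobNorm_pairMatrix_sq, Real.sqrt_sq (frobNorm_nonneg _)]

lemma signalSize_eq (a : EuclideanSpace ℝ (Fin d₁)) (b : EuclideanSpace ℝ (Fin d₂)) :
    signalSize a b = ‖a‖ * ‖b‖ := by
  have h : Matrix.vecMulVec (WithLp.ofLp a) (WithLp.ofLp b) = pairMatrix a b 0 0 := by
    simp [pairMatrix]
  rw [signalSize, h, frobNorm_pairMatrix, pairNormSq]
  simp only [norm_zero, inner_zero_right]
  rw [← mul_pow]
  simp [Real.sqrt_sq, mul_nonneg]

lemma rank_pairMatrix_le (a : EuclideanSpace ℝ (Fin d₁)) (b : EuclideanSpace ℝ (Fin d₂))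
    (c : EuclideanSpace ℝ (Fin d₁)) (d : EuclideanSpace ℝ (Fin d₂)) :
    (pairMatrix a b c d).rank ≤ 2 := by
  have h : pairMatrix a b c d =
      (Matrix.of fun i => ![a i, c i]) * (Matrix.of ![WithLp.ofLp b, WithLp.ofLp d]) := by
    ext i j
    simp [pairMatrix, Matrix.mul_apply, Matrix.vecMulVec_apply, Fin.sum_univ_two]
  rw [h]
  exact (Matrix.rank_mul_le_left _ _).trans
    ((Matrix.rank_le_width _))

lemma dotProduct_pairMatrix_mulVec (a : EuclideanSpace ℝ (Fin d₁))
    (b : EuclideanSpace ℝ (Fin d₂)) (c : EuclideanSpace ℝ (Fin d₁))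
    (d : EuclideanSpace ℝ (Fin d₂)) (l : EuclideanSpace ℝ (Fin d₁))
    (r : EuclideanSpace ℝ (Fin d₂)) :
    dotProduct (WithLp.ofLp l) ((pairMatrix a b c d).mulVec (WithLp.ofLp r)) =
      inner ℝ l a * inner ℝ r b + inner ℝ l c * inner ℝ r d := by
  rw [pairMatrix, Matrix.add_mulVec, dotProduct_add, Matrix.vecMulVec_mulVec,
    Matrix.vecMulVec_mulVec]
  simp only [EuclideanSpace.inner_eq_star_dotProduct, star_trivial]
  simp [dotProduct_comm, mul_comm]

end FrobeniusRank

/-! ### The penalty on a well-conditioned sample -/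

section MeanAbs

variable {m : ℕ}

lemma meanAbs_add_le (u v : Fin m → ℝ) : meanAbs (u + v) ≤ meanAbs u + meanAbs v := by
  rw [meanAbs, meanAbs, meanAbs, ← mul_add, ← Finset.sum_add_distrib]
  gcongr with i
  exact abs_add_le _ _

lemma meanAbs_smul (c : ℝ) (v : Fin m → ℝ) : meanAbs (c • v) = |c| * meanAbs v := by
  simp only [meanAbs, Pi.smul_apply, smul_eq_mul, abs_mul, ← Finset.mul_sum]
  ring

lemma abs_meanAbs_sub_le (u v : Fin m → ℝ) : |meanAbs u - meanAbs v| ≤ meanAbs (u - v) := by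
  have h1 := meanAbs_add_le (u - v) v
  have h2 := meanAbs_add_le (v - u) u
  have h3 : meanAbs (v - u) = meanAbs (u - v) := by simp only [meanAbs, Pi.sub_apply, abs_sub_comm]
  rw [sub_add_cancel] at h1 h2
  rw [abs_le]
  constructor <;> linarith

end MeanAbs

/-- The weight of a measurement: `-1` for outliers and `1` otherwise. -/
noncomputable def outlierSign {m : ℕ} (Iout : Finset (Fin m)) (i : Fin m) : ℝ :=
  if i ∈ Iout then -1 else 1

section Sample

variable {m d₁ d₂ : ℕ}

/-- The two deterministic properties of the measurement vectors behind the convergence of the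
algorithms: the averages of `|⟪ℓ_i, u⟫ ⟪r_i, v⟫|` are at most `K ‖u‖ ‖v‖`, and on every matrix
`a bᵀ + c dᵀ` the inliers outweigh the outliers by `κ` times its Frobenius norm. -/
structure IsWellConditioned (ℓ : Fin m → EuclideanSpace ℝ (Fin d₁))
    (r : Fin m → EuclideanSpace ℝ (Fin d₂)) (Iout : Finset (Fin m)) (K κ : ℝ) : Prop where
  upper : ∀ u v, meanAbs (fun i => inner ℝ (ℓ i) u * inner ℝ (r i) v) ≤ K * (‖u‖ * ‖v‖)
  lower : ∀ a b c d, κ * √(pairNormSq a b c d) ≤ (1 / (m : ℝ)) * ∑ i, outlierSign Iout i *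
    |inner ℝ (ℓ i) a * inner ℝ (r i) b + inner ℝ (ℓ i) c * inner ℝ (r i) d|

variable (ℓ : Fin m → EuclideanSpace ℝ (Fin d₁)) (r : Fin m → EuclideanSpace ℝ (Fin d₂))
  (y : Fin m → ℝ)

lemma fderiv_mul_sub_const {E : Type*} [NormedAddCommGroup E] [NormedSpace ℝ E]
    (g k : Fin m → E →L[ℝ] ℝ) (y : Fin m → ℝ) (z v : E) :
    fderiv ℝ (fun z i => g i z * k i z - y i) z v = fun i => g i z * k i v + g i v * k i z := by
  have h : ∀ i, HasFDerivAt (fun z => g i z * k i z - y i) (g i z • k i + k i z • g i) z :=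
    fun i => (((g i).hasFDerivAt (x := z)).mul ((k i).hasFDerivAt (x := z))).sub_const (y i)
  rw [(hasFDerivAt_pi.2 h).fderiv]
  ext i
  simp only [ContinuousLinearMap.coe_pi', add_apply, smul_apply, smul_eq_mul]
  ring

lemma fderiv_bilinResidual (z v : PairSpace d₁ d₂) :
    fderiv ℝ (bilinResidual ℓ r y) z v = fun i =>
      inner ℝ (ℓ i) z.fst * inner ℝ (r i) v.snd + inner ℝ (ℓ i) v.fst * inner ℝ (r i) z.snd :=
  fderiv_mul_sub_const (E := PairSpace d₁ d₂)
    (fun i => (innerSL ℝ (ℓ i)).comp (WithLp.fstL 2 ℝ _ _))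
    (fun i => (innerSL ℝ (r i)).comp (WithLp.sndL 2 ℝ _ _)) y z v

lemma bilinResidual_expand (z u : PairSpace d₁ d₂) :
    bilinResidual ℓ r y u - (bilinResidual ℓ r y z + fderiv ℝ (bilinResidual ℓ r y) z (u - z)) =
      fun i => inner ℝ (ℓ i) (u - z).fst * inner ℝ (r i) (u - z).snd := by
  ext i
  rw [fderiv_bilinResidual]
  simp only [bilinResidual, Pi.sub_apply, Pi.add_apply, WithLp.sub_fst, WithLp.sub_snd,
    inner_sub_right]
  ring

/-- The convex model of the penalty at `z` obtained by linearizing the residual. -/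
noncomputable def linearizedPenalty (z u : PairSpace d₁ d₂) : ℝ :=
  meanAbs (bilinResidual ℓ r y z + fderiv ℝ (bilinResidual ℓ r y) z (u - z))

lemma linearizedPenalty_self (z : PairSpace d₁ d₂) :
    linearizedPenalty ℓ r y z z = penalty ℓ r y z := by
  simp [linearizedPenalty, penalty]

lemma convexOn_linearizedPenalty (z : PairSpace d₁ d₂) :
    ConvexOn ℝ Set.univ (linearizedPenalty ℓ r y z) := by
  refine ⟨convex_univ, fun u _ v _ a b ha hb hab => ?_⟩
  set T := fderiv ℝ (bilinResidual ℓ r y) z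
  set F := bilinResidual ℓ r y z
  have e : F + T (a • u + b • v - z) = a • (F + T (u - z)) + b • (F + T (v - z)) := by
    simp only [map_sub, map_add, map_smul]
    have : F - T z = a • (F - T z) + b • (F - T z) := by rw [← add_smul, hab, one_smul]
    calc _ = (F - T z) + (a • T u + b • T v) := by abel
      _ = _ := by
        rw [this]
        simp only [smul_sub, smul_add]
        abel
  change meanAbs (F + T (a • u + b • v - z)) ≤
    a • meanAbs (F + T (u - z)) + b • meanAbs (F + T (v - z))
  rw [e]
  refine (meanAbs_add_le _ _).trans (le_of_eq ?_)
  rw [meanAbs_smul, meanAbs_smul, abs_of_nonneg ha, abs_of_nonneg hb, smul_eq_mul, smul_eq_mul]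

variable {ℓ r} {Iout : Finset (Fin m)} {K κ : ℝ}

lemma IsWellConditioned.abs_penalty_sub_le (h : IsWellConditioned ℓ r Iout K κ) (hK : 0 ≤ K)
    (z u : PairSpace d₁ d₂) :
    |penalty ℓ r y u - linearizedPenalty ℓ r y z u| ≤ K / 2 * ‖u - z‖ ^ 2 := by
  refine (abs_meanAbs_sub_le _ _).trans ?_
  rw [bilinResidual_expand]
  refine (h.upper _ _).trans ?_
  rw [WithLp.prod_norm_sq_eq_of_L2]
  nlinarith [sq_nonneg (‖(u - z).fst‖ - ‖(u - z).snd‖)]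

/-- Testing the model inequality at `z + ζ` bounds `‖ζ‖²` by the size of the linear part. -/
lemma IsWellConditioned.norm_subgradient_le (h : IsWellConditioned ℓ r Iout K κ) (hK : 0 ≤ K)
    {B : ℝ} {z ζ : PairSpace d₁ d₂} (h1 : ‖z.fst‖ ≤ B) (h2 : ‖z.snd‖ ≤ B)
    (hζ : ∀ u, penalty ℓ r y z + inner ℝ ζ (u - z) ≤ linearizedPenalty ℓ r y z u) :
    ‖ζ‖ ≤ √2 * (K * B) := by
  have hB : 0 ≤ B := (norm_nonneg _).trans h1
  have h3 := hζ (z + ζ)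
  rw [add_sub_cancel_left, real_inner_self_eq_norm_sq, linearizedPenalty,
    add_sub_cancel_left] at h3
  have h4 := meanAbs_add_le (bilinResidual ℓ r y z) (fderiv ℝ (bilinResidual ℓ r y) z ζ)
  have h5 : meanAbs (fderiv ℝ (bilinResidual ℓ r y) z ζ) ≤
      K * (‖z.fst‖ * ‖ζ.snd‖) + K * (‖ζ.fst‖ * ‖z.snd‖) := by
    rw [fderiv_bilinResidual]
    exact (meanAbs_add_le _ _).trans (add_le_add (h.upper _ _) (h.upper _ _))
  have h6 : ‖ζ.fst‖ + ‖ζ.snd‖ ≤ √2 * ‖ζ‖ := by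
    rw [← Real.sqrt_sq (norm_nonneg ζ), ← Real.sqrt_mul (by norm_num),
      WithLp.prod_norm_sq_eq_of_L2]
    apply Real.le_sqrt_of_sq_le
    nlinarith [sq_nonneg (‖ζ.fst‖ - ‖ζ.snd‖)]
  have h7 : K * (‖z.fst‖ * ‖ζ.snd‖) + K * (‖ζ.fst‖ * ‖z.snd‖) ≤
      K * B * (‖ζ.fst‖ + ‖ζ.snd‖) := by
    have e1 := mul_le_mul_of_nonneg_right h1 (norm_nonneg ζ.snd)
    have e2 := mul_le_mul_of_nonneg_left h2 (norm_nonneg ζ.fst)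
    have := mul_le_mul_of_nonneg_left (add_le_add e1 e2) hK
    linarith
  have h8 : K * B * (‖ζ.fst‖ + ‖ζ.snd‖) ≤ K * B * (√2 * ‖ζ‖) :=
    mul_le_mul_of_nonneg_left h6 (by positivity)
  have h9 : ‖ζ‖ * ‖ζ‖ ≤ √2 * (K * B) * ‖ζ‖ := by
    have : penalty ℓ r y z = meanAbs (bilinResidual ℓ r y z) := rfl
    nlinarith
  rcases (norm_nonneg ζ).eq_or_lt with h0 | h0
  · rw [← h0]; positivity
  · exact le_of_mul_le_mul_right h9 h0

/-- Corrupted measurements can lower the penalty by at most what the outliers contribute. -/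
lemma penalty_sub_ge (wbar w : EuclideanSpace ℝ (Fin d₁)) (xbar x : EuclideanSpace ℝ (Fin d₂))
    (ξ : Fin m → ℝ) :
    (1 / (m : ℝ)) * ∑ i, outlierSign Iout i *
        |inner ℝ (ℓ i) w * inner ℝ (r i) x + inner ℝ (ℓ i) (-wbar) * inner ℝ (r i) xbar| ≤
      penalty ℓ r (measurements ℓ r wbar xbar Iout ξ) (WithLp.toLp 2 (w, x)) -
        penalty ℓ r (measurements ℓ r wbar xbar Iout ξ) (WithLp.toLp 2 (wbar, xbar)) := by
  rw [penalty, penalty, meanAbs, meanAbs, ← mul_sub, ← Finset.sum_sub_distrib]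
  gcongr with i
  simp only [bilinResidual, measurements, outlierSign, inner_neg_right, WithLp.toLp_fst,
    WithLp.toLp_snd]
  split_ifs with hi
  · have := abs_sub_abs_le_abs_sub (inner ℝ (ℓ i) wbar * inner ℝ (r i) xbar - ξ i)
      (inner ℝ (ℓ i) w * inner ℝ (r i) x - ξ i)
    have e : inner ℝ (ℓ i) wbar * inner ℝ (r i) xbar - ξ i -
        (inner ℝ (ℓ i) w * inner ℝ (r i) x - ξ i) =
        -(inner ℝ (ℓ i) w * inner ℝ (r i) x + -inner ℝ (ℓ i) wbar * inner ℝ (r i) xbar) := by ring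
    rw [e, abs_neg] at this
    linarith
  · rw [sub_self, abs_zero, one_mul, sub_zero, neg_mul, ← sub_eq_add_neg]

lemma convex_feasibleSet (ν : ℝ) (wbar : EuclideanSpace ℝ (Fin d₁))
    (xbar : EuclideanSpace ℝ (Fin d₂)) : Convex ℝ (feasibleSet ν wbar xbar) := by
  have h : ∀ {V : Type} [NormedAddCommGroup V] [InnerProductSpace ℝ V] (g : PairSpace d₁ d₂ →L[ℝ] V)
      (B : ℝ), Convex ℝ {z | ‖g z‖ ≤ B} := by
    intro V _ _ g B
    have := (convex_closedBall (0 : V) B).linear_preimage g.toLinearMap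
    simpa [Set.preimage, Metric.closedBall] using this
  exact (h (WithLp.fstL 2 ℝ _ _) _).inter (h (WithLp.sndL 2 ℝ _ _) _)

lemma isCompact_solutionSet {ν : ℝ} (hν : 0 < ν) (wbar : EuclideanSpace ℝ (Fin d₁))
    (xbar : EuclideanSpace ℝ (Fin d₂)) : IsCompact (solutionSet ν wbar xbar) := by
  have hI : IsCompact {α : ℝ | 1 / ν ≤ |α| ∧ |α| ≤ ν} := by
    have hsub : {α : ℝ | 1 / ν ≤ |α| ∧ |α| ≤ ν} ⊆ Metric.closedBall 0 ν := by
      intro α hα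
      simpa using hα.2
    refine (isCompact_closedBall (0 : ℝ) ν).of_isClosed_subset ?_ hsub
    exact (isClosed_le continuous_const continuous_abs).inter
      (isClosed_le continuous_abs continuous_const)
  have e : solutionSet ν wbar xbar =
      (fun α : ℝ => (WithLp.toLp 2 (α • wbar, (1 / α) • xbar) : PairSpace d₁ d₂)) ''
        {α : ℝ | 1 / ν ≤ |α| ∧ |α| ≤ ν} := by
    ext z
    constructor
    · rintro ⟨α, h1, h2, rfl⟩; exact ⟨α, ⟨h1, h2⟩, rfl⟩
    · rintro ⟨α, ⟨h1, h2⟩, rfl⟩; exact ⟨α, h1, h2, rfl⟩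
  rw [e]
  refine hI.image_of_continuousOn ?_
  refine (WithLp.prod_continuous_toLp 2 _ _).comp_continuousOn ?_
  have hinv : ContinuousOn (fun α : ℝ => 1 / α) {α : ℝ | 1 / ν ≤ |α| ∧ |α| ≤ ν} := by
    refine continuousOn_const.div continuousOn_id ?_
    rintro α ⟨h1, -⟩ h0
    change α = 0 at h0
    rw [h0, abs_zero] at h1
    exact absurd h1 (not_le.2 (by positivity))
  exact (continuousOn_id.smul continuousOn_const).prodMk (hinv.smul continuousOn_const)

/-- On a well-conditioned sample the problem is sharp and weakly convex: the lower property and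
`exists_scaling` give sharpness, the upper property gives weak convexity and the subgradient
bound. -/
theorem IsWellConditioned.isSharpWeaklyConvex (h : IsWellConditioned ℓ r Iout K κ) (hK : 0 < K)
    (hκ : 0 < κ) {wbar : EuclideanSpace ℝ (Fin d₁)} {xbar : EuclideanSpace ℝ (Fin d₂)}
    (hw : wbar ≠ 0) (hwx : ‖wbar‖ = ‖xbar‖) {ν M : ℝ} (hν : 1 ≤ ν) (hM : M = signalSize wbar xbar)
    (ξ : Fin m → ℝ) :
    IsSharpWeaklyConvex (penalty ℓ r (measurements ℓ r wbar xbar Iout ξ))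
      (feasibleSet ν wbar xbar) (solutionSet ν wbar xbar)
      (penalty ℓ r (measurements ℓ r wbar xbar Iout ξ) (WithLp.toLp 2 (wbar, xbar)))
      (κ * √M / (2 * √2 * (ν + 1))) K (√2 * (K * (ν * √M))) := by
  have hν0 : 0 < ν := by linarith
  have hMw : ‖wbar‖ ^ 2 = M := by rw [hM, signalSize_eq, ← hwx, sq]
  have hMx : ‖xbar‖ ^ 2 = M := by rw [← hwx, hMw]
  have hM0 : 0 < M := by rw [← hMw]; positivity
  have hsw : ‖wbar‖ = √M := by rw [← hMw, Real.sqrt_sq (norm_nonneg _)]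
  have hsx : ‖xbar‖ = √M := by rw [← hwx, hsw]
  have hmodel : ∀ z ζ, ζ ∈ frechetSubdiff (penalty ℓ r (measurements ℓ r wbar xbar Iout ξ)) z →
      ∀ u, penalty ℓ r (measurements ℓ r wbar xbar Iout ξ) z + inner ℝ ζ (u - z) ≤
        linearizedPenalty ℓ r (measurements ℓ r wbar xbar Iout ξ) z u := fun z ζ hζ u =>
    frechetSubdiff.le_of_convex_model (ρ := K) (convexOn_linearizedPenalty ℓ r _ z)
      (linearizedPenalty_self ℓ r _ z)
      (fun u => by have := (abs_le.1 (h.abs_penalty_sub_le (measurements ℓ r wbar xbar Iout ξ)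
        hK.le z u)).2; linarith) hζ u
  refine
    { convex := convex_feasibleSet ν wbar xbar
      compact := isCompact_solutionSet hν0 wbar xbar
      nonempty := ⟨_, 1, by simpa using inv_le_one_of_one_le₀ hν, by simpa using hν, rfl⟩
      subset := ?_
      eq_min := ?_
      sharp := ?_
      subgradient := ?_
      norm_le := fun z hz ζ hζ => ?_
      sharp_pos := by positivity
      weak_pos := hK }
  · rintro _ ⟨α, h1, h2, rfl⟩
    have hα : 0 < |α| := lt_of_lt_of_le (by positivity) h1
    refine ⟨?_, ?_⟩
    · rw [← hM, WithLp.toLp_fst, norm_smul, hsw, Real.norm_eq_abs]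
      exact mul_le_mul_of_nonneg_right h2 (Real.sqrt_nonneg _)
    · rw [← hM, WithLp.toLp_snd, norm_smul, hsx, Real.norm_eq_abs, abs_div, abs_one]
      exact mul_le_mul_of_nonneg_right ((one_div_le hν0 hα).1 h1) (Real.sqrt_nonneg _)
  · rintro _ ⟨α, h1, h2, rfl⟩
    have hα : α ≠ 0 := by
      rintro rfl
      rw [abs_zero] at h1
      exact absurd h1 (not_le.2 (by positivity))
    rw [penalty, penalty]
    congr 1
    ext i
    simp only [bilinResidual, WithLp.toLp_fst, WithLp.toLp_snd, inner_smul_right]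
    field_simp
  · intro z hz
    obtain ⟨hz1, hz2⟩ := hz
    rw [← hM] at hz1 hz2
    obtain ⟨α, h1, h2, h3⟩ := exists_scaling hν hM0 hMw hMx hz1 hz2
    have hd : Metric.infDist z (solutionSet ν wbar xbar) ^ 2 ≤
        ‖z.fst - α • wbar‖ ^ 2 + ‖z.snd - (1 / α) • xbar‖ ^ 2 := by
      have : Metric.infDist z (solutionSet ν wbar xbar) ≤
          dist z (WithLp.toLp 2 (α • wbar, (1 / α) • xbar)) :=
        Metric.infDist_le_dist_of_mem ⟨α, h1, h2, rfl⟩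
      refine (pow_le_pow_left₀ Metric.infDist_nonneg this 2).trans (le_of_eq ?_)
      rw [dist_eq_norm, WithLp.prod_norm_sq_eq_of_L2]
      simp
    have hlow := (h.lower z.fst z.snd (-wbar) xbar).trans (penalty_sub_ge wbar z.fst xbar z.snd ξ)
    refine le_trans ?_ hlow
    have hN : pairNormSq z.fst z.snd (-wbar) xbar =
        ‖z.fst‖ ^ 2 * ‖z.snd‖ ^ 2 - 2 * (inner ℝ z.fst wbar * inner ℝ z.snd xbar) + M ^ 2 := by
      rw [pairNormSq, norm_neg, inner_neg_right, hMw, hMx]; ring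
    rw [← hN] at h3
    have hgap : √M * Metric.infDist z (solutionSet ν wbar xbar) ≤
        2 * √2 * (ν + 1) * √(pairNormSq z.fst z.snd (-wbar) xbar) := by
      refine le_of_sq_le_sq ?_ (by positivity)
      rw [mul_pow, mul_pow, Real.sq_sqrt hM0.le, Real.sq_sqrt (pairNormSq_nonneg _ _ _ _)]
      have e : (2 * √2 * (ν + 1)) ^ 2 = 8 * (ν + 1) ^ 2 := by
        rw [mul_pow, mul_pow, Real.sq_sqrt (by norm_num)]; ring
      rw [e]
      exact (mul_le_mul_of_nonneg_left hd hM0.le).trans h3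
    have hs2 : 0 < 2 * √2 * (ν + 1) := by positivity
    rw [div_mul_eq_mul_div, div_le_iff₀ hs2]
    have := mul_le_mul_of_nonneg_left hgap hκ.le
    linarith
  · intro z _ ζ hζ u
    have h1 := hmodel z ζ hζ u
    have h2 := (abs_le.1 (h.abs_penalty_sub_le (measurements ℓ r wbar xbar Iout ξ) hK.le z u)).1
    linarith
  · rw [feasibleSet, ← hM] at hz
    exact h.norm_subgradient_le _ hK.le hz.1 hz.2 (hmodel z ζ hζ)

end Sample

/-! ### Nets of the unit ball -/

section Nets

variable {E : Type*} [NormedAddCommGroup E] [NormedSpace ℝ E] [FiniteDimensional ℝ E]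

/-- Volume comparison of the disjoint balls of radius `ε / 2` around the points of `s` with the
ball of radius `1 + ε / 2`. -/
lemma card_le_of_separated_unitBall {ε : ℝ} (hε : 0 < ε) (hε1 : ε ≤ 1) (s : Finset E)
    (hs : ∀ c ∈ s, ‖c‖ ≤ 1) (h : ∀ c ∈ s, ∀ d ∈ s, c ≠ d → ε ≤ ‖c - d‖) :
    (s.card : ℝ) ≤ (3 / ε) ^ Module.finrank ℝ E := by
  borelize E
  let μ : Measure E := Measure.addHaar
  have hδ : 0 < ε / 2 := by positivity
  have hρ : 0 < 1 + ε / 2 := by positivity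
  set A := ⋃ c ∈ s, Metric.ball (c : E) (ε / 2) with hA
  have D : Set.Pairwise (s : Set E) (Function.onFun Disjoint fun c => Metric.ball c (ε / 2)) := by
    rintro c hc d hd hcd
    apply Metric.ball_disjoint_ball
    rw [dist_eq_norm, add_halves]
    exact h c hc d hd hcd
  have A_subset : A ⊆ Metric.ball (0 : E) (1 + ε / 2) := by
    refine Set.iUnion₂_subset fun x hx => ?_
    apply Metric.ball_subset_ball'
    rw [dist_zero_right]
    linarith [hs x hx]
  have I : (s.card : ENNReal) * ENNReal.ofReal ((ε / 2) ^ Module.finrank ℝ E) *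
      μ (Metric.ball 0 1) ≤
      ENNReal.ofReal ((1 + ε / 2) ^ Module.finrank ℝ E) * μ (Metric.ball 0 1) :=
    calc _ = μ A := by
          rw [hA, measure_biUnion_finset D fun c _ => measurableSet_ball]
          simp only [μ.addHaar_ball_of_pos _ hδ]
          simp only [Finset.sum_const, nsmul_eq_mul, mul_assoc]
      _ ≤ μ (Metric.ball (0 : E) (1 + ε / 2)) := measure_mono A_subset
      _ = _ := by simp only [μ.addHaar_ball_of_pos _ hρ]
  have J : (s.card : ENNReal) * ENNReal.ofReal ((ε / 2) ^ Module.finrank ℝ E) ≤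
      ENNReal.ofReal ((1 + ε / 2) ^ Module.finrank ℝ E) :=
    (ENNReal.mul_le_mul_iff_left (Metric.measure_ball_pos _ _ zero_lt_one).ne'
      measure_ball_lt_top.ne).1 I
  have L := ENNReal.toReal_le_of_le_ofReal (pow_nonneg hρ.le _) J
  rw [ENNReal.toReal_mul, ENNReal.toReal_natCast, ENNReal.toReal_ofReal (by positivity)] at L
  have hquot : (1 + ε / 2) / (ε / 2) ≤ 3 / ε := by
    rw [div_le_div_iff₀ hδ hε]
    nlinarith
  calc (s.card : ℝ) ≤ (1 + ε / 2) ^ Module.finrank ℝ E / (ε / 2) ^ Module.finrank ℝ E := by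
        rwa [le_div_iff₀ (by positivity)]
    _ = ((1 + ε / 2) / (ε / 2)) ^ Module.finrank ℝ E := (div_pow _ _ _).symm
    _ ≤ _ := pow_le_pow_left₀ (by positivity) hquot _

/-- `s` is a finite `ε`-net of the closed unit ball, contained in that ball. -/
structure IsUnitBallNet (s : Finset E) (ε : ℝ) : Prop where
  norm_le_one : ∀ c ∈ s, ‖c‖ ≤ 1
  exists_near : ∀ u : E, ‖u‖ ≤ 1 → ∃ c ∈ s, ‖u - c‖ ≤ ε

variable (E) in
/-- A separated set of maximal cardinality is a net. -/
lemma exists_isUnitBallNet {ε : ℝ} (hε : 0 < ε) (hε1 : ε ≤ 1) :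
    ∃ s : Finset E, IsUnitBallNet s ε ∧ (s.card : ℝ) ≤ (3 / ε) ^ Module.finrank ℝ E := by
  classical
  let C : Set ℕ := {n | ∃ s : Finset E, (∀ c ∈ s, ‖c‖ ≤ 1) ∧
    (∀ c ∈ s, ∀ d ∈ s, c ≠ d → ε ≤ ‖c - d‖) ∧ s.card = n}
  have hbdd : BddAbove C := by
    refine ⟨⌊(3 / ε) ^ Module.finrank ℝ E⌋₊, ?_⟩
    rintro _ ⟨s, h1, h2, rfl⟩
    exact Nat.le_floor (card_le_of_separated_unitBall hε hε1 s h1 h2)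
  have hne : C.Nonempty := ⟨0, ∅, by simp, by simp, by simp⟩
  obtain ⟨s, h1, h2, hcard⟩ := Nat.sSup_mem hne hbdd
  refine ⟨s, ⟨h1, fun u hu => ?_⟩, card_le_of_separated_unitBall hε hε1 s h1 h2⟩
  by_contra! hfar
  have hus : u ∉ s := fun hmem => by
    have := hfar u hmem
    rw [sub_self, norm_zero] at this
    linarith
  have hmem : s.card + 1 ∈ C := by
    refine ⟨insert u s, ?_, ?_, Finset.card_insert_of_notMem hus⟩
    · intro c hc
      rcases Finset.mem_insert.1 hc with rfl | hc
      · exact hu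
      · exact h1 c hc
    · intro c hc d hd hcd
      rcases Finset.mem_insert.1 hc with hcu | hcs <;> rcases Finset.mem_insert.1 hd with hdu | hds
      · exact absurd (hcu.trans hdu.symm) hcd
      · rw [hcu]; exact (hfar d hds).le
      · rw [hdu, norm_sub_rev]; exact (hfar c hcs).le
      · exact h2 c hcs d hds hcd
  have := le_csSup hbdd hmem
  omega

end Nets

/-! ### Extension of bounds from nets -/

section NetArguments

/-- A quadratic bound on a `1/2`-net of the unit ball holds everywhere up to a factor four. -/
lemma sum_inner_sq_le_of_net {E : Type*} [NormedAddCommGroup E] [InnerProductSpace ℝ E]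
    [FiniteDimensional ℝ E] {m : ℕ} (v : Fin m → E) {s : Finset E} (hs : IsUnitBallNet s (1 / 2))
    {B : ℝ} (hB : 0 ≤ B) (h : ∀ c ∈ s, ∑ i, (inner ℝ (v i) c) ^ 2 ≤ B) (u : E) :
    ∑ i, (inner ℝ (v i) u) ^ 2 ≤ 4 * B * ‖u‖ ^ 2 := by
  let T : E →L[ℝ] EuclideanSpace ℝ (Fin m) :=
    (EuclideanSpace.equiv (Fin m) ℝ).symm.toContinuousLinearMap.comp
      (ContinuousLinearMap.pi fun i => innerSL ℝ (v i))
  have hT : ∀ w, ‖T w‖ ^ 2 = ∑ i, (inner ℝ (v i) w) ^ 2 := by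
    intro w
    rw [EuclideanSpace.real_norm_sq_eq]
    rfl
  have hop : ‖T‖ ≤ √B + ‖T‖ * (1 / 2) := by
    refine T.opNorm_le_of_unit_norm (by positivity) fun w hw => ?_
    obtain ⟨c, hc, hwc⟩ := hs.exists_near w hw.le
    have h1 : ‖T c‖ ≤ √B := Real.le_sqrt_of_sq_le (by rw [hT]; exact h c hc)
    have h2 : ‖T (w - c)‖ ≤ ‖T‖ * (1 / 2) :=
      (T.le_opNorm _).trans (mul_le_mul_of_nonneg_left hwc (norm_nonneg _))
    calc ‖T w‖ = ‖T c + T (w - c)‖ := by rw [← map_add, add_sub_cancel]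
      _ ≤ ‖T c‖ + ‖T (w - c)‖ := norm_add_le _ _
      _ ≤ _ := add_le_add h1 h2
  have hTu : ‖T u‖ ≤ 2 * √B * ‖u‖ :=
    (T.le_opNorm u).trans (mul_le_mul_of_nonneg_right (by linarith) (norm_nonneg _))
  have := pow_le_pow_left₀ (norm_nonneg _) hTu 2
  rw [hT, mul_pow, mul_pow, Real.sq_sqrt hB] at this
  linarith

variable {m d₁ d₂ : ℕ} {ℓ : Fin m → EuclideanSpace ℝ (Fin d₁)}
  {r : Fin m → EuclideanSpace ℝ (Fin d₂)}

lemma meanAbs_mul_le_of_net {s₁ : Finset (EuclideanSpace ℝ (Fin d₁))}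
    {s₂ : Finset (EuclideanSpace ℝ (Fin d₂))} (hs₁ : IsUnitBallNet s₁ (1 / 2))
    (hs₂ : IsUnitBallNet s₂ (1 / 2)) (hm : 0 < m) {B : ℝ} (hB : 0 ≤ B)
    (h₁ : ∀ c ∈ s₁, ∑ i, (inner ℝ (ℓ i) c) ^ 2 ≤ B * m)
    (h₂ : ∀ c ∈ s₂, ∑ i, (inner ℝ (r i) c) ^ 2 ≤ B * m)
    (u : EuclideanSpace ℝ (Fin d₁)) (v : EuclideanSpace ℝ (Fin d₂)) :
    meanAbs (fun i => inner ℝ (ℓ i) u * inner ℝ (r i) v) ≤ 4 * B * (‖u‖ * ‖v‖) := by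
  have hm' : (0 : ℝ) < m := by exact_mod_cast hm
  have hBm : 0 ≤ B * m := by positivity
  have e₁ := sum_inner_sq_le_of_net ℓ hs₁ hBm h₁ u
  have e₂ := sum_inner_sq_le_of_net r hs₂ hBm h₂ v
  have hcs := Finset.sum_mul_sq_le_sq_mul_sq Finset.univ
    (fun i => |inner ℝ (ℓ i) u|) (fun i => |inner ℝ (r i) v|)
  simp only [sq_abs, ← abs_mul] at hcs
  have hsq : (∑ i, |inner ℝ (ℓ i) u * inner ℝ (r i) v|) ^ 2 ≤
      (4 * B * (‖u‖ * ‖v‖) * m) ^ 2 := by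
    refine hcs.trans ((mul_le_mul e₁ e₂ (Finset.sum_nonneg fun i _ => sq_nonneg _)
      (by positivity)).trans (le_of_eq (by ring)))
  have := le_of_sq_le_sq hsq (by positivity)
  rw [meanAbs, one_div, inv_mul_le_iff₀ hm']
  linarith

/-- Orthonormalizing the column space: `a bᵀ + c dᵀ = e₁ pᵀ + e₂ qᵀ` with `e₁ ⟂ e₂` of norm one (or
zero, if the rank is smaller), so that the Frobenius norm is that of `(p, q)`. -/
lemma exists_orthogonal_pairMatrix (a : EuclideanSpace ℝ (Fin d₁)) (b : EuclideanSpace ℝ (Fin d₂))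
    (c : EuclideanSpace ℝ (Fin d₁)) (d : EuclideanSpace ℝ (Fin d₂)) :
    ∃ e₁ p e₂ q, ‖e₁‖ ≤ 1 ∧ ‖e₂‖ ≤ 1 ∧ pairMatrix a b c d = pairMatrix e₁ p e₂ q ∧
      pairNormSq a b c d = ‖p‖ ^ 2 + ‖q‖ ^ 2 := by
  have unit : ∀ v : EuclideanSpace ℝ (Fin d₁),
      ‖‖v‖⁻¹ • v‖ ≤ 1 ∧ v = ‖v‖ • (‖v‖⁻¹ • v) := by
    intro v
    by_cases hv : v = 0
    · simp [hv]
    · have hn : ‖v‖ ≠ 0 := norm_ne_zero_iff.2 hv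
      refine ⟨by rw [norm_smul, norm_inv, norm_norm, inv_mul_cancel₀ hn], ?_⟩
      rw [smul_smul, mul_inv_cancel₀ hn, one_smul]
  set e₁ := ‖a‖⁻¹ • a with he₁
  obtain ⟨h1, ha⟩ := unit a
  rw [← he₁] at h1 ha
  set t : ℝ := inner ℝ e₁ c with ht
  set c' := c - t • e₁ with hc'
  obtain ⟨h2, hc⟩ := unit c'
  refine ⟨e₁, ‖a‖ • b + t • d, ‖c'‖⁻¹ • c', ‖c'‖ • d, h1, h2, ?_, ?_⟩
  · have hcc : c = t • e₁ + ‖c'‖ • (‖c'‖⁻¹ • c') := by rw [← hc, hc']; abel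
    set e₂ := ‖c'‖⁻¹ • c'
    ext i j
    have hai : a i = ‖a‖ * e₁ i := by
      have := congrArg (fun v : EuclideanSpace ℝ (Fin d₁) => v i) ha
      simpa only [PiLp.smul_apply, smul_eq_mul] using this
    have hci : c i = t * e₁ i + ‖c'‖ * e₂ i := by
      have := congrArg (fun v : EuclideanSpace ℝ (Fin d₁) => v i) hcc
      simpa only [PiLp.add_apply, PiLp.smul_apply, smul_eq_mul] using this
    simp only [pairMatrix, Matrix.add_apply, Matrix.vecMulVec_apply, PiLp.add_apply,
      PiLp.smul_apply, smul_eq_mul]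
    linear_combination b j * hai + d j * hci
  · have hac : inner ℝ a c = ‖a‖ * t := by
      conv_lhs => rw [ha]
      rw [real_inner_smul_left]
    have hcn : ‖c‖ ^ 2 = t ^ 2 + ‖c'‖ ^ 2 := by
      have h3 : ‖c'‖ ^ 2 = ‖c‖ ^ 2 - 2 * t ^ 2 + t ^ 2 * ‖e₁‖ ^ 2 := by
        rw [hc', norm_sub_sq_real, inner_smul_right, real_inner_comm, ← ht, norm_smul, mul_pow,
          Real.norm_eq_abs, sq_abs]
        ring
      have h4 : t ^ 2 * ‖e₁‖ ^ 2 = t ^ 2 := by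
        by_cases hz : a = 0
        · have : t = 0 := by rw [ht, he₁, hz, smul_zero, inner_zero_left]
          rw [this]; ring
        · have hn : ‖a‖ ≠ 0 := norm_ne_zero_iff.2 hz
          rw [he₁, norm_smul, norm_inv, norm_norm, inv_mul_cancel₀ hn]; ring
      linarith
    rw [pairNormSq, hac, hcn, norm_add_sq_real, norm_smul, norm_smul, norm_smul,
      real_inner_smul_left, inner_smul_right, Real.norm_eq_abs, Real.norm_eq_abs, Real.norm_eq_abs,
      mul_pow, mul_pow, mul_pow, sq_abs, sq_abs, sq_abs]
    ring

end NetArguments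

/-! ### Exponential concentration -/

section Chernoff

/-- Chernoff bound for independent variables with a common law. -/
lemma measureReal_le_sum_le_exp {Ω V : Type*} [MeasurableSpace Ω] [MeasurableSpace V]
    {P : Measure Ω} [IsProbabilityMeasure P] {D : Measure V} {m : ℕ} {X : Fin m → Ω → V}
    (hlaw : ∀ i, HasLaw (X i) D P) (hindep : iIndepFun X P) {g : Fin m → V → ℝ}
    (hg : ∀ i, Measurable (g i)) {b : Fin m → ℝ}
    (hint : ∀ i, Integrable (fun a => Real.exp (g i a)) D)
    (hb : ∀ i, ∫ a, Real.exp (g i a) ∂D ≤ Real.exp (b i)) (t : ℝ) :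
    P.real {ω | t ≤ ∑ i, g i (X i ω)} ≤ Real.exp (∑ i, b i - t) := by
  rcases Nat.eq_zero_or_pos m with rfl | hm
  · simp only [Finset.univ_eq_empty, Finset.sum_empty, zero_sub]
    by_cases ht : t ≤ 0
    · exact measureReal_le_one.trans (Real.one_le_exp (by linarith))
    · simp [ht, Real.exp_nonneg]
  have hD : IsProbabilityMeasure D := by
    rw [← (hlaw ⟨0, hm⟩).map_eq]
    exact Measure.isProbabilityMeasure_map (hlaw ⟨0, hm⟩).aemeasurable
  have hprod : ∫ ω, ∏ i, Real.exp (g i (X i ω)) ∂P = ∏ i, ∫ a, Real.exp (g i a) ∂D := by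
    rw [hindep.integral_fun_prod_comp (fun i => (hlaw i).aemeasurable)
      (f := fun i a => Real.exp (g i a)) (fun i => (hg i).exp.aestronglyMeasurable)]
    refine Finset.prod_congr rfl fun i _ => ?_
    exact (hlaw i).integral_comp (f := fun a => Real.exp (g i a))
      (hg i).exp.aestronglyMeasurable
  have hpos : 0 < ∫ ω, ∏ i, Real.exp (g i (X i ω)) ∂P := by
    rw [hprod]
    exact Finset.prod_pos fun i _ => integral_exp_pos (hint i)
  -- A nonzero Bochner integral forces integrability.
  have hI : Integrable (fun ω => ∏ i, Real.exp (g i (X i ω))) P := by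
    by_contra hn
    rw [integral_undef hn] at hpos
    exact lt_irrefl _ hpos
  have hmarkov := mul_meas_ge_le_integral_of_nonneg
    (ae_of_all P fun ω => Finset.prod_nonneg fun i _ => (Real.exp_pos (g i (X i ω))).le) hI
    (Real.exp t)
  rw [hprod] at hmarkov
  have hset : {ω | Real.exp t ≤ ∏ i, Real.exp (g i (X i ω))} = {ω | t ≤ ∑ i, g i (X i ω)} := by
    ext ω
    simp only [Set.mem_ofPred_eq]
    rw [← Real.exp_sum, Real.exp_le_exp]
  rw [hset] at hmarkov
  have hbound : ∏ i, ∫ a, Real.exp (g i a) ∂D ≤ Real.exp (∑ i, b i) := by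
    rw [Real.exp_sum]
    exact Finset.prod_le_prod (fun i _ => (integral_exp_pos (hint i)).le) fun i _ => hb i
  rw [Real.exp_sub, le_div_iff₀ (Real.exp_pos t), mul_comm]
  exact hmarkov.trans hbound

/-- A quadratic upper bound for `exp (-s y)` with `|s|` at most `1 / 2`, whose error term is
controlled by `exp y`. -/
lemma exp_neg_mul_le {y l : ℝ} (hy : 0 ≤ y) (hl0 : 0 ≤ l) (hl : l ≤ 1 / 2) {σ : ℝ}
    (hσ : σ = 1 ∨ σ = -1) :
    Real.exp (-(l * (σ * y))) ≤ 1 - l * (σ * y) + 8 * l ^ 2 * Real.exp y := by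
  have hly : 0 ≤ l * y := mul_nonneg hl0 hy
  have hsq : y ^ 2 ≤ 8 * Real.exp (y / 2) := by
    have := Real.quadratic_le_exp_of_nonneg (by positivity : 0 ≤ y / 2)
    nlinarith
  have hhalf : Real.exp (y / 2) * Real.exp (y / 2) = Real.exp y := by
    rw [← Real.exp_add, add_halves]
  have h1 : 1 ≤ Real.exp (y / 2) := Real.one_le_exp (by positivity)
  have hexp : (l * y) ^ 2 * Real.exp (y / 2) ≤ 8 * l ^ 2 * Real.exp y := by
    rw [← hhalf, mul_pow]
    have := mul_le_mul_of_nonneg_left hsq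
      (mul_nonneg (sq_nonneg l) (by linarith : (0 : ℝ) ≤ Real.exp (y / 2)))
    linarith
  rcases hσ with rfl | rfl
  · have h2 : Real.exp (-(l * (1 * y))) ≤ 1 - l * (1 * y) + (l * y) ^ 2 := by
      rw [one_mul, Real.exp_neg, inv_le_iff_one_le_mul₀ (Real.exp_pos _)]
      have h3 := Real.add_one_le_exp (l * y)
      have h4 : 0 ≤ 1 - l * y + (l * y) ^ 2 := by nlinarith [sq_nonneg (l * y - 1)]
      have h5 := mul_le_mul_of_nonneg_left h3 h4
      have e : (1 - l * y + (l * y) ^ 2) * (l * y + 1) = 1 + (l * y) ^ 3 := by ring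
      have : 0 ≤ (l * y) ^ 3 := by positivity
      linarith
    have h6 : (l * y) ^ 2 ≤ (l * y) ^ 2 * Real.exp (y / 2) := le_mul_of_one_le_right (sq_nonneg _) h1
    linarith
  · have h2 : Real.exp (l * y) ≤ 1 + l * y + (l * y) ^ 2 * Real.exp (l * y) := by
      have h3 := Real.add_one_le_exp (-(l * y))
      have h4 := mul_le_mul_of_nonneg_right h3
        (mul_nonneg (by linarith : 0 ≤ 1 + l * y) (Real.exp_pos (l * y)).le)
      have e : Real.exp (-(l * y)) * ((1 + l * y) * Real.exp (l * y)) = 1 + l * y := by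
        rw [mul_left_comm, ← Real.exp_add, neg_add_cancel, Real.exp_zero, mul_one]
      rw [e] at h4
      linarith
    have h5 : Real.exp (l * y) ≤ Real.exp (y / 2) := Real.exp_le_exp.2 (by nlinarith)
    have h6 := mul_le_mul_of_nonneg_left h5 (sq_nonneg (l * y))
    have e : -(l * (-1 * y)) = l * y := by ring
    rw [e]
    linarith

section SubExponential

variable {V : Type*} [MeasurableSpace V] {D : Measure V} {Y : V → ℝ}

lemma integrable_of_exp (hY : Measurable Y) (hY0 : ∀ a, 0 ≤ Y a)
    (hint : Integrable (fun a => Real.exp (Y a)) D) : Integrable Y D := by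
  refine hint.mono' hY.aestronglyMeasurable (ae_of_all _ fun a => ?_)
  rw [Real.norm_of_nonneg (hY0 a)]
  linarith [Real.add_one_le_exp (Y a)]

lemma integrable_exp_neg_mul (hY : Measurable Y) (hY0 : ∀ a, 0 ≤ Y a)
    (hint : Integrable (fun a => Real.exp (Y a)) D) {l : ℝ} (hl0 : 0 ≤ l) (hl : l ≤ 1 / 2)
    {σ : ℝ} (hσ : σ = 1 ∨ σ = -1) : Integrable (fun a => Real.exp (-(l * (σ * Y a)))) D := by
  refine hint.mono' (by fun_prop) (ae_of_all _ fun a => ?_)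
  rw [Real.norm_of_nonneg (Real.exp_pos _).le, Real.exp_le_exp]
  have := hY0 a
  rcases hσ with rfl | rfl <;> nlinarith

lemma integral_exp_neg_mul_le [IsProbabilityMeasure D] (hY : Measurable Y) (hY0 : ∀ a, 0 ≤ Y a)
    (hint : Integrable (fun a => Real.exp (Y a)) D) (hexp : ∫ a, Real.exp (Y a) ∂D ≤ 2) {l : ℝ}
    (hl0 : 0 ≤ l) (hl : l ≤ 1 / 2) {σ : ℝ} (hσ : σ = 1 ∨ σ = -1) :
    ∫ a, Real.exp (-(l * (σ * Y a))) ∂D ≤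
      Real.exp (-(l * (σ * ∫ a, Y a ∂D)) + 16 * l ^ 2) := by
  have hYi := integrable_of_exp hY hY0 hint
  have i1 : Integrable (fun a => l * (σ * Y a)) D := (hYi.const_mul σ).const_mul l
  have i2 : Integrable (fun a => 8 * l ^ 2 * Real.exp (Y a)) D := hint.const_mul _
  have i3 : Integrable (fun a => 1 - l * (σ * Y a)) D := (integrable_const 1).sub i1
  calc _ ≤ ∫ a, (1 - l * (σ * Y a) + 8 * l ^ 2 * Real.exp (Y a)) ∂D :=
        integral_mono (integrable_exp_neg_mul hY hY0 hint hl0 hl hσ) (i3.add i2)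
          fun a => exp_neg_mul_le (hY0 a) hl0 hl hσ
    _ = 1 - l * (σ * ∫ a, Y a ∂D) + 8 * l ^ 2 * ∫ a, Real.exp (Y a) ∂D := by
        rw [integral_add i3 i2, integral_sub (integrable_const 1) i1, integral_const_mul,
          integral_const_mul, integral_const_mul]
        simp
    _ ≤ 1 - l * (σ * ∫ a, Y a ∂D) + 8 * l ^ 2 * 2 := by gcongr
    _ ≤ _ := by
        have := Real.add_one_le_exp (-(l * (σ * ∫ a, Y a ∂D)) + 16 * l ^ 2)
        linarith

/-- Lower tail of a signed sum of i.i.d. copies of a nonnegative sub-exponential variable whose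
signs have the average `Δ`. -/
lemma measureReal_signed_sum_le [IsProbabilityMeasure D] {Ω : Type*} [MeasurableSpace Ω] {P : Measure Ω}
    [IsProbabilityMeasure P] {m : ℕ} {X : Fin m → Ω → V} (hlaw : ∀ i, HasLaw (X i) D P)
    (hindep : iIndepFun X P) (hY : Measurable Y) (hY0 : ∀ a, 0 ≤ Y a)
    (hint : Integrable (fun a => Real.exp (Y a)) D) (hexp : ∫ a, Real.exp (Y a) ∂D ≤ 2)
    {σ : Fin m → ℝ} (hσ : ∀ i, σ i = 1 ∨ σ i = -1) {Δ a : ℝ} (hΔ0 : 0 ≤ Δ) (hΔ1 : Δ ≤ 1)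
    (hsum : ∑ i, σ i = Δ * m) (ha0 : 0 ≤ a) (ha : a ≤ ∫ x, Y x ∂D) :
    P.real {ω | ∑ i, σ i * Y (X i ω) ≤ Δ * m * (a / 2)} ≤
      Real.exp (-(Δ ^ 2 * a ^ 2 * m / 256)) := by
  have ha1 : a ≤ 1 := by
    have h1 : ∫ x, (Y x + 1) ∂D ≤ ∫ x, Real.exp (Y x) ∂D :=
      integral_mono ((integrable_of_exp hY hY0 hint).add (integrable_const 1)) hint
        fun x => Real.add_one_le_exp (Y x)
    rw [integral_add (integrable_of_exp hY hY0 hint) (integrable_const 1)] at h1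
    simp only [integral_const, probReal_univ, smul_eq_mul, mul_one] at h1
    linarith
  -- This `l` minimizes the resulting exponent `16 l² m - l Δ m a / 2`.
  set l := Δ * a / 64 with hl
  have hl0 : 0 ≤ l := by positivity
  have hl1 : l ≤ 1 / 2 := by
    have : Δ * a ≤ 1 := mul_le_one₀ hΔ1 ha0 ha1
    linarith
  have key := measureReal_le_sum_le_exp hlaw hindep (g := fun i x => -(l * (σ i * Y x)))
    (fun i => by fun_prop) (b := fun i => -(l * (σ i * ∫ x, Y x ∂D)) + 16 * l ^ 2)
    (fun i => integrable_exp_neg_mul hY hY0 hint hl0 hl1 (hσ i))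
    (fun i => integral_exp_neg_mul_le hY hY0 hint hexp hl0 hl1 (hσ i)) (-(l * (Δ * m * (a / 2))))
  refine le_trans (measureReal_mono ?_) (key.trans (Real.exp_le_exp.2 ?_))
  · intro ω hω
    simp only [Set.mem_ofPred_eq] at hω ⊢
    rw [Finset.sum_neg_distrib, ← Finset.mul_sum, neg_le_neg_iff]
    exact mul_le_mul_of_nonneg_left hω hl0
  · rw [Finset.sum_add_distrib, Finset.sum_neg_distrib, ← Finset.mul_sum, ← Finset.sum_mul, hsum,
      Finset.sum_const, Finset.card_univ, Fintype.card_fin, nsmul_eq_mul]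
    have hm : (0 : ℝ) ≤ m := Nat.cast_nonneg m
    have h1 : l * (Δ * m * a) ≤ l * (Δ * m * ∫ x, Y x ∂D) :=
      mul_le_mul_of_nonneg_left (mul_le_mul_of_nonneg_left ha (by positivity)) hl0
    have e : l * (Δ * m * a) - l * (Δ * m * (a / 2)) - m * (16 * l ^ 2) =
        Δ ^ 2 * a ^ 2 * m / 256 := by rw [hl]; ring
    linarith

end SubExponential

end Chernoff

/-! ### Tails of the measurement model -/

section Model

lemma lintegral_exp_inner_sq_le {d : ℕ} {η : ℝ} {D : Measure (EuclideanSpace ℝ (Fin d))}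
    [IsProbabilityMeasure D] (hD : IsSubGaussianLaw η D) {u : EuclideanSpace ℝ (Fin d)}
    (hu : ‖u‖ ≤ 1) : ∫⁻ a, ENNReal.ofReal (Real.exp ((inner ℝ a u) ^ 2 / η ^ 2)) ∂D ≤ 2 := by
  by_cases h0 : u = 0
  · subst h0
    simp
  · have hn : ‖u‖ ≠ 0 := norm_ne_zero_iff.2 h0
    refine le_trans (lintegral_mono fun a => ?_) (hD (‖u‖⁻¹ • u)
      (by rw [norm_smul, norm_inv, norm_norm, inv_mul_cancel₀ hn]))
    refine ENNReal.ofReal_le_ofReal (Real.exp_le_exp.2 ?_)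
    gcongr ?_ / _
    rw [real_inner_smul_left, real_inner_comm a u, mul_pow]
    refine le_mul_of_one_le_left (sq_nonneg _) (one_le_pow₀ ?_)
    exact (one_le_inv₀ (by positivity)).2 hu

lemma integrable_exp_inner_sq {d : ℕ} {η : ℝ} {D : Measure (EuclideanSpace ℝ (Fin d))}
    [IsProbabilityMeasure D] (hD : IsSubGaussianLaw η D) {u : EuclideanSpace ℝ (Fin d)}
    (hu : ‖u‖ ≤ 1) : Integrable (fun a => Real.exp ((inner ℝ a u) ^ 2 / η ^ 2)) D ∧
      ∫ a, Real.exp ((inner ℝ a u) ^ 2 / η ^ 2) ∂D ≤ 2 := by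
  have hmeas : Measurable fun a : EuclideanSpace ℝ (Fin d) =>
      Real.exp ((inner ℝ a u) ^ 2 / η ^ 2) := by fun_prop
  have h := lintegral_exp_inner_sq_le hD hu
  have h0 : 0 ≤ᵐ[D] fun a => Real.exp ((inner ℝ a u) ^ 2 / η ^ 2) :=
    ae_of_all _ fun a => (Real.exp_pos _).le
  refine ⟨⟨hmeas.aestronglyMeasurable, ?_⟩, ?_⟩
  · rw [hasFiniteIntegral_iff_ofReal h0]
    exact h.trans_lt ENNReal.ofNat_lt_top
  · rw [integral_eq_lintegral_of_nonneg_ae h0 hmeas.aestronglyMeasurable]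
    exact ENNReal.toReal_le_of_le_ofReal (by norm_num) (by simpa using h)

lemma Real.exp_avg_four_le (a b c d : ℝ) : Real.exp ((a + b + c + d) / 4) ≤
    (Real.exp a + Real.exp b + Real.exp c + Real.exp d) / 4 := by
  have h2 : ∀ s t : ℝ, Real.exp ((s + t) / 2) ≤ (Real.exp s + Real.exp t) / 2 := by
    intro s t
    have := convexOn_exp.2 (Set.mem_univ s) (Set.mem_univ t) (by norm_num : (0 : ℝ) ≤ 1 / 2)
      (by norm_num : (0 : ℝ) ≤ 1 / 2) (by norm_num)
    simp only [smul_eq_mul] at this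
    calc _ = Real.exp (1 / 2 * s + 1 / 2 * t) := by ring_nf
      _ ≤ _ := this
      _ = _ := by ring
  have e : (a + b + c + d) / 4 = ((a + b) / 2 + (c + d) / 2) / 2 := by ring
  rw [e]
  linarith [h2 ((a + b) / 2) ((c + d) / 2), h2 a b, h2 c d]

variable {d₁ d₂ : ℕ} {η μ₀ p₀ : ℝ} {Dl : Measure (EuclideanSpace ℝ (Fin d₁))}
  {Dr : Measure (EuclideanSpace ℝ (Fin d₂))} [IsProbabilityMeasure Dl] [IsProbabilityMeasure Dr]

/-- The bilinear form of `e₁ pᵀ + e₂ qᵀ` at `(ℓ, r)`, in absolute value and scaled by `2 η²`. -/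
noncomputable def scaledForm (η : ℝ) (e₁ : EuclideanSpace ℝ (Fin d₁))
    (p : EuclideanSpace ℝ (Fin d₂)) (e₂ : EuclideanSpace ℝ (Fin d₁))
    (q : EuclideanSpace ℝ (Fin d₂))
    (a : EuclideanSpace ℝ (Fin d₁) × EuclideanSpace ℝ (Fin d₂)) : ℝ :=
  |inner ℝ a.1 e₁ * inner ℝ a.2 p + inner ℝ a.1 e₂ * inner ℝ a.2 q| / (2 * η ^ 2)

variable {e₁ e₂ : EuclideanSpace ℝ (Fin d₁)} {p q : EuclideanSpace ℝ (Fin d₂)}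

lemma measurable_scaledForm : Measurable (scaledForm η e₁ p e₂ q) := by
  unfold scaledForm
  refine Measurable.div_const ?_ _
  refine Measurable.abs ?_
  fun_prop

lemma scaledForm_nonneg (a) : 0 ≤ scaledForm η e₁ p e₂ q a := by
  unfold scaledForm; positivity

lemma exp_scaledForm_le (a : EuclideanSpace ℝ (Fin d₁) × EuclideanSpace ℝ (Fin d₂)) :
    Real.exp (scaledForm η e₁ p e₂ q a) ≤
      (Real.exp ((inner ℝ a.1 e₁) ^ 2 / η ^ 2) + Real.exp ((inner ℝ a.2 p) ^ 2 / η ^ 2) +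
        Real.exp ((inner ℝ a.1 e₂) ^ 2 / η ^ 2) + Real.exp ((inner ℝ a.2 q) ^ 2 / η ^ 2)) / 4 := by
  refine le_trans (Real.exp_le_exp.2 ?_) (Real.exp_avg_four_le _ _ _ _)
  have h : ∀ s t : ℝ, |s * t| ≤ (s ^ 2 + t ^ 2) / 2 := fun s t => by
    rw [abs_le]; constructor <;> nlinarith [sq_nonneg (s + t), sq_nonneg (s - t)]
  have h2 := (abs_add_le (inner ℝ a.1 e₁ * inner ℝ a.2 p) (inner ℝ a.1 e₂ * inner ℝ a.2 q)).trans
    (add_le_add (h _ _) (h _ _))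
  have e : ((inner ℝ a.1 e₁) ^ 2 / η ^ 2 + (inner ℝ a.2 p) ^ 2 / η ^ 2 +
      (inner ℝ a.1 e₂) ^ 2 / η ^ 2 + (inner ℝ a.2 q) ^ 2 / η ^ 2) / 4 =
      (((inner ℝ a.1 e₁) ^ 2 + (inner ℝ a.2 p) ^ 2) / 2 +
        ((inner ℝ a.1 e₂) ^ 2 + (inner ℝ a.2 q) ^ 2) / 2) / (2 * η ^ 2) := by
    by_cases hη : η = 0
    · simp [hη]
    · field_simp; ring
  rw [e, scaledForm]
  gcongr

/-- Independence of the two factors is not needed here: the exponential is dominated by an average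
of four sub-gaussian ones. -/
lemma integrable_exp_scaledForm (hl : IsSubGaussianLaw η Dl) (hr : IsSubGaussianLaw η Dr)
    (h₁ : ‖e₁‖ ≤ 1) (h₂ : ‖p‖ ≤ 1) (h₃ : ‖e₂‖ ≤ 1) (h₄ : ‖q‖ ≤ 1) :
    Integrable (fun a => Real.exp (scaledForm η e₁ p e₂ q a)) (Dl.prod Dr) ∧
      ∫ a, Real.exp (scaledForm η e₁ p e₂ q a) ∂(Dl.prod Dr) ≤ 2 := by
  have left : ∀ u : EuclideanSpace ℝ (Fin d₁), ‖u‖ ≤ 1 →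
      Integrable (fun a : EuclideanSpace ℝ (Fin d₁) × EuclideanSpace ℝ (Fin d₂) =>
        Real.exp ((inner ℝ a.1 u) ^ 2 / η ^ 2)) (Dl.prod Dr) ∧
      ∫ a, Real.exp ((inner ℝ a.1 u) ^ 2 / η ^ 2) ∂(Dl.prod Dr) ≤ 2 := by
    intro u hu
    obtain ⟨hi, hb⟩ := integrable_exp_inner_sq hl hu
    refine ⟨hi.comp_fst Dr, ?_⟩
    rw [integral_fun_fst (fun a => Real.exp ((inner ℝ a u) ^ 2 / η ^ 2))]
    simpa using hb
  have right : ∀ u : EuclideanSpace ℝ (Fin d₂), ‖u‖ ≤ 1 →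
      Integrable (fun a : EuclideanSpace ℝ (Fin d₁) × EuclideanSpace ℝ (Fin d₂) =>
        Real.exp ((inner ℝ a.2 u) ^ 2 / η ^ 2)) (Dl.prod Dr) ∧
      ∫ a, Real.exp ((inner ℝ a.2 u) ^ 2 / η ^ 2) ∂(Dl.prod Dr) ≤ 2 := by
    intro u hu
    obtain ⟨hi, hb⟩ := integrable_exp_inner_sq hr hu
    refine ⟨hi.comp_snd Dl, ?_⟩
    rw [integral_fun_snd (fun a => Real.exp ((inner ℝ a u) ^ 2 / η ^ 2))]
    simpa using hb
  obtain ⟨i1, b1⟩ := left e₁ h₁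
  obtain ⟨i2, b2⟩ := right p h₂
  obtain ⟨i3, b3⟩ := left e₂ h₃
  obtain ⟨i4, b4⟩ := right q h₄
  have i12 := i1.add i2
  have i123 := i12.add i3
  have i1234 := (i123.add i4).div_const 4
  have hi : Integrable (fun a => Real.exp (scaledForm η e₁ p e₂ q a)) (Dl.prod Dr) := by
    refine i1234.mono' measurable_scaledForm.exp.aestronglyMeasurable (ae_of_all _ fun a => ?_)
    rw [Real.norm_of_nonneg (Real.exp_pos _).le]
    exact exp_scaledForm_le a
  refine ⟨hi, (integral_mono hi i1234 exp_scaledForm_le).trans ?_⟩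
  have e := integral_add i123 i4
  have e' := integral_add i12 i3
  have e'' := integral_add i1 i2
  simp only [Pi.add_apply] at e e' e'' ⊢
  rw [integral_div, e, e', e'']
  linarith

/-- The small-ball condition bounds the mean of the form from below. -/
lemma le_integral_scaledForm (hη : 0 < η) (hμ₀ : 0 < μ₀)
    (hnd : ∀ X : Matrix (Fin d₁) (Fin d₂) ℝ, X.rank ≤ 2 → frobNorm X = 1 →
      p₀ ≤ (Dl.prod Dr).real
        {a | μ₀ ≤ |dotProduct (WithLp.ofLp a.1) (X.mulVec (WithLp.ofLp a.2))|})
    (hint : Integrable (scaledForm η e₁ p e₂ q) (Dl.prod Dr))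
    (hF : 1 / 2 ≤ frobNorm (pairMatrix e₁ p e₂ q)) :
    μ₀ * p₀ / (4 * η ^ 2) ≤ ∫ a, scaledForm η e₁ p e₂ q a ∂(Dl.prod Dr) := by
  set F := frobNorm (pairMatrix e₁ p e₂ q) with hFdef
  have hF0 : 0 < F := by linarith
  have hscale : frobNorm (pairMatrix e₁ (F⁻¹ • p) e₂ (F⁻¹ • q)) = 1 := by
    have h1 : frobNorm (pairMatrix e₁ (F⁻¹ • p) e₂ (F⁻¹ • q)) ^ 2 = 1 := by
      rw [frobNorm_pairMatrix_sq, pairNormSq, norm_smul, norm_smul, real_inner_smul_left,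
        inner_smul_right, Real.norm_of_nonneg (inv_nonneg.2 hF0.le)]
      have h2 : F ^ 2 = _ := frobNorm_pairMatrix_sq e₁ p e₂ q
      rw [pairNormSq] at h2
      calc _ = F⁻¹ ^ 2 * (‖e₁‖ ^ 2 * ‖p‖ ^ 2 + ‖e₂‖ ^ 2 * ‖q‖ ^ 2 +
            2 * (inner ℝ e₁ e₂ * inner ℝ p q)) := by ring
        _ = 1 := by rw [← h2, ← mul_pow, inv_mul_cancel₀ hF0.ne', one_pow]
    exact (pow_eq_one_iff_of_nonneg (frobNorm_nonneg _) two_ne_zero).1 h1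
  have hP := hnd _ (rank_pairMatrix_le _ _ _ _) hscale
  have hM := mul_meas_ge_le_integral_of_nonneg (ae_of_all _ scaledForm_nonneg) hint
    (μ₀ / (4 * η ^ 2))
  have hsub : {a : EuclideanSpace ℝ (Fin d₁) × EuclideanSpace ℝ (Fin d₂) | μ₀ ≤
      |dotProduct (WithLp.ofLp a.1)
        ((pairMatrix e₁ (F⁻¹ • p) e₂ (F⁻¹ • q)).mulVec (WithLp.ofLp a.2))|} ⊆
      {a | μ₀ / (4 * η ^ 2) ≤ scaledForm η e₁ p e₂ q a} := by
    intro a ha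
    simp only [Set.mem_ofPred_eq] at ha ⊢
    rw [dotProduct_pairMatrix_mulVec, inner_smul_right, inner_smul_right, mul_left_comm,
      mul_left_comm _ F⁻¹, ← mul_add, abs_mul, abs_of_pos (inv_pos.2 hF0),
      le_inv_mul_iff₀ hF0] at ha
    rw [scaledForm, div_le_div_iff₀ (by positivity) (by positivity)]
    have h3 : 1 / 2 * μ₀ ≤ F * μ₀ := mul_le_mul_of_nonneg_right hF hμ₀.le
    have := mul_le_mul_of_nonneg_right (h3.trans ha) (by positivity : 0 ≤ 4 * η ^ 2)
    linarith
  have hmono : p₀ ≤ (Dl.prod Dr).real {a | μ₀ / (4 * η ^ 2) ≤ scaledForm η e₁ p e₂ q a} :=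
    hP.trans (measureReal_mono hsub)
  calc _ = μ₀ / (4 * η ^ 2) * p₀ := by ring
    _ ≤ _ := mul_le_mul_of_nonneg_left hmono (by positivity)
    _ ≤ _ := hM

end Model

/-! ### Signed means on all matrices of rank at most two -/

section NetToAll

variable {m d₁ d₂ : ℕ}

/-- The measurements `ℓ_iᵀ A r_i` of a matrix `A`. -/
def matrixForm (ℓ : Fin m → EuclideanSpace ℝ (Fin d₁)) (r : Fin m → EuclideanSpace ℝ (Fin d₂))
    (A : Matrix (Fin d₁) (Fin d₂) ℝ) : Fin m → ℝ :=
  fun i => dotProduct (WithLp.ofLp (ℓ i)) (A.mulVec (WithLp.ofLp (r i)))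

/-- The average of `|v_i|` in which the outliers count negatively. -/
noncomputable def signedMeanAbs (Iout : Finset (Fin m)) (v : Fin m → ℝ) : ℝ :=
  (1 / (m : ℝ)) * ∑ i, outlierSign Iout i * |v i|

lemma outlierSign_eq (Iout : Finset (Fin m)) (i : Fin m) :
    outlierSign Iout i = 1 ∨ outlierSign Iout i = -1 := by
  unfold outlierSign; split_ifs <;> simp

lemma sum_outlierSign (Iout : Finset (Fin m)) :
    ∑ i, outlierSign Iout i = (m : ℝ) - 2 * Iout.card := by
  have h : ∀ i, outlierSign Iout i = 1 - 2 * (if i ∈ Iout then (1 : ℝ) else 0) := by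
    intro i; unfold outlierSign; split_ifs <;> norm_num
  simp only [h, Finset.sum_sub_distrib, ← Finset.mul_sum, Finset.sum_ite_mem]
  simp

lemma signedMeanAbs_sub_le (Iout : Finset (Fin m)) (u v : Fin m → ℝ) :
    signedMeanAbs Iout u - meanAbs (u - v) ≤ signedMeanAbs Iout v := by
  rw [signedMeanAbs, signedMeanAbs, meanAbs, ← mul_sub, ← Finset.sum_sub_distrib]
  gcongr with i
  have h := abs_le.1 (abs_abs_sub_abs_le_abs_sub (u i) (v i))
  rw [Pi.sub_apply]
  rcases outlierSign_eq Iout i with h1 | h1 <;> rw [h1] <;> linarith [h.1, h.2]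

lemma signedMeanAbs_smul (Iout : Finset (Fin m)) {c : ℝ} (hc : 0 ≤ c) (v : Fin m → ℝ) :
    signedMeanAbs Iout (c • v) = c * signedMeanAbs Iout v := by
  simp only [signedMeanAbs, Pi.smul_apply, smul_eq_mul, abs_mul, abs_of_nonneg hc, Finset.mul_sum]
  refine Finset.sum_congr rfl fun i _ => ?_
  ring

lemma pairMatrix_smul (t : ℝ) (a : EuclideanSpace ℝ (Fin d₁)) (b : EuclideanSpace ℝ (Fin d₂))
    (c : EuclideanSpace ℝ (Fin d₁)) (d : EuclideanSpace ℝ (Fin d₂)) :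
    pairMatrix a (t • b) c (t • d) = t • pairMatrix a b c d := by
  ext i j
  simp only [pairMatrix, Matrix.add_apply, Matrix.smul_apply, Matrix.vecMulVec_apply,
    PiLp.smul_apply, smul_eq_mul]
  ring

lemma frobNorm_smul (t : ℝ) (A : Matrix (Fin d₁) (Fin d₂) ℝ) :
    frobNorm (t • A) = |t| * frobNorm A := by
  open scoped Matrix.Norms.Frobenius in
  exact norm_smul t A

lemma frobNorm_add_le (A B : Matrix (Fin d₁) (Fin d₂) ℝ) :
    frobNorm (A + B) ≤ frobNorm A + frobNorm B := by
  open scoped Matrix.Norms.Frobenius in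
  exact norm_add_le A B

lemma frobNorm_pairMatrix_le (a : EuclideanSpace ℝ (Fin d₁)) (b : EuclideanSpace ℝ (Fin d₂))
    (c : EuclideanSpace ℝ (Fin d₁)) (d : EuclideanSpace ℝ (Fin d₂)) :
    frobNorm (pairMatrix a b c d) ≤ ‖a‖ * ‖b‖ + ‖c‖ * ‖d‖ := by
  rw [← signalSize_eq, ← signalSize_eq]
  exact frobNorm_add_le _ _

variable {ℓ : Fin m → EuclideanSpace ℝ (Fin d₁)} {r : Fin m → EuclideanSpace ℝ (Fin d₂)}
  {Iout : Finset (Fin m)} {K : ℝ}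

lemma matrixForm_add (A B : Matrix (Fin d₁) (Fin d₂) ℝ) :
    matrixForm ℓ r (A + B) = matrixForm ℓ r A + matrixForm ℓ r B := by
  ext i
  simp [matrixForm, Matrix.add_mulVec]

lemma matrixForm_smul (t : ℝ) (A : Matrix (Fin d₁) (Fin d₂) ℝ) :
    matrixForm ℓ r (t • A) = t • matrixForm ℓ r A := by
  ext i
  simp [matrixForm, Matrix.smul_mulVec]

lemma matrixForm_pairMatrix (a : EuclideanSpace ℝ (Fin d₁)) (b : EuclideanSpace ℝ (Fin d₂))
    (c : EuclideanSpace ℝ (Fin d₁)) (d : EuclideanSpace ℝ (Fin d₂)) :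
    matrixForm ℓ r (pairMatrix a b c d) =
      fun i => inner ℝ (ℓ i) a * inner ℝ (r i) b + inner ℝ (ℓ i) c * inner ℝ (r i) d :=
  funext fun _ => dotProduct_pairMatrix_mulVec _ _ _ _ _ _

lemma meanAbs_matrixForm_pairMatrix_le
    (hupper : ∀ u v, meanAbs (fun i => inner ℝ (ℓ i) u * inner ℝ (r i) v) ≤ K * (‖u‖ * ‖v‖))
    (a : EuclideanSpace ℝ (Fin d₁)) (b : EuclideanSpace ℝ (Fin d₂))
    (c : EuclideanSpace ℝ (Fin d₁)) (d : EuclideanSpace ℝ (Fin d₂)) :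
    meanAbs (matrixForm ℓ r (pairMatrix a b c d)) ≤ K * (‖a‖ * ‖b‖ + ‖c‖ * ‖d‖) := by
  rw [matrixForm_pairMatrix, mul_add]
  exact (meanAbs_add_le _ _).trans (add_le_add (hupper _ _) (hupper _ _))

/-- Replacing the factors of a matrix of unit Frobenius norm by points of the nets changes its
Frobenius norm by at most `4 ε` and its mean measurements by at most `4 K ε`. -/
lemma le_signedMeanAbs_of_net (hK : 0 ≤ K)
    (hupper : ∀ u v, meanAbs (fun i => inner ℝ (ℓ i) u * inner ℝ (r i) v) ≤ K * (‖u‖ * ‖v‖))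
    {s₁ : Finset (EuclideanSpace ℝ (Fin d₁))} {s₂ : Finset (EuclideanSpace ℝ (Fin d₂))} {ε θ : ℝ}
    (hs₁ : IsUnitBallNet s₁ ε) (hs₂ : IsUnitBallNet s₂ ε) (hε : ε ≤ 1 / 8) (hθ : 8 * K * ε ≤ θ)
    (hnet : ∀ e₁ ∈ s₁, ∀ p ∈ s₂, ∀ e₂ ∈ s₁, ∀ q ∈ s₂, 1 / 2 ≤ frobNorm (pairMatrix e₁ p e₂ q) →
      θ ≤ signedMeanAbs Iout (matrixForm ℓ r (pairMatrix e₁ p e₂ q)))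
    {e₁ e₂ : EuclideanSpace ℝ (Fin d₁)} {p q : EuclideanSpace ℝ (Fin d₂)}
    (h₁ : ‖e₁‖ ≤ 1) (h₂ : ‖p‖ ≤ 1) (h₃ : ‖e₂‖ ≤ 1) (h₄ : ‖q‖ ≤ 1)
    (hF : frobNorm (pairMatrix e₁ p e₂ q) = 1) :
    θ / 2 ≤ signedMeanAbs Iout (matrixForm ℓ r (pairMatrix e₁ p e₂ q)) := by
  obtain ⟨e₁', he₁, n₁⟩ := hs₁.exists_near e₁ h₁
  obtain ⟨p', hp, n₂⟩ := hs₂.exists_near p h₂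
  obtain ⟨e₂', he₂, n₃⟩ := hs₁.exists_near e₂ h₃
  obtain ⟨q', hq, n₄⟩ := hs₂.exists_near q h₄
  set A := pairMatrix e₁ p e₂ q
  set A' := pairMatrix e₁' p' e₂' q'
  set B₁ := pairMatrix (e₁ - e₁') p e₁' (p - p')
  set B₂ := pairMatrix (e₂ - e₂') q e₂' (q - q')
  have hdecomp : A = A' + (B₁ + B₂) := by
    ext i j
    simp only [A, A', B₁, B₂, pairMatrix, Matrix.add_apply, Matrix.vecMulVec_apply, PiLp.sub_apply]
    ring
  have small : ∀ (e e' : EuclideanSpace ℝ (Fin d₁)) (v v' : EuclideanSpace ℝ (Fin d₂)),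
      ‖v‖ ≤ 1 → ‖e'‖ ≤ 1 → ‖e - e'‖ ≤ ε → ‖v - v'‖ ≤ ε →
      ‖e - e'‖ * ‖v‖ + ‖e'‖ * ‖v - v'‖ ≤ 2 * ε := by
    intro e e' v v' g1 g2 g3 g4
    have k1 := mul_le_of_le_one_right (norm_nonneg (e - e')) g1
    have k2 := mul_le_of_le_one_left (norm_nonneg (v - v')) g2
    linarith
  have t₁ := small e₁ e₁' p p' h₂ (hs₁.norm_le_one _ he₁) n₁ n₂
  have t₂ := small e₂ e₂' q q' h₄ (hs₁.norm_le_one _ he₂) n₃ n₄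
  have hfrob : 1 / 2 ≤ frobNorm A' := by
    have f1 := frobNorm_add_le A' (B₁ + B₂)
    have f2 := frobNorm_add_le B₁ B₂
    have f3 : frobNorm B₁ ≤ _ := frobNorm_pairMatrix_le _ _ _ _
    have f4 : frobNorm B₂ ≤ _ := frobNorm_pairMatrix_le _ _ _ _
    rw [← hdecomp, hF] at f1
    linarith
  have hlow := hnet e₁' he₁ p' hp e₂' he₂ q' hq hfrob
  have hdiff : meanAbs (matrixForm ℓ r A' - matrixForm ℓ r A) ≤ K * (2 * ε) + K * (2 * ε) := by
    have e : matrixForm ℓ r A' - matrixForm ℓ r A =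
        (-1 : ℝ) • (matrixForm ℓ r B₁ + matrixForm ℓ r B₂) := by
      rw [hdecomp, matrixForm_add, matrixForm_add, neg_one_smul]; abel
    rw [e, meanAbs_smul, abs_neg, abs_one, one_mul]
    refine (meanAbs_add_le _ _).trans (add_le_add ?_ ?_)
    · exact (meanAbs_matrixForm_pairMatrix_le hupper _ _ _ _).trans
        (mul_le_mul_of_nonneg_left t₁ hK)
    · exact (meanAbs_matrixForm_pairMatrix_le hupper _ _ _ _).trans
        (mul_le_mul_of_nonneg_left t₂ hK)
  have := signedMeanAbs_sub_le Iout (matrixForm ℓ r A') (matrixForm ℓ r A)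
  linarith

/-- By homogeneity and orthonormalization of the column space, it is enough to consider factors in
the unit balls, which the nets approximate. -/
theorem isWellConditioned_of_net (hK : 0 ≤ K)
    (hupper : ∀ u v, meanAbs (fun i => inner ℝ (ℓ i) u * inner ℝ (r i) v) ≤ K * (‖u‖ * ‖v‖))
    {s₁ : Finset (EuclideanSpace ℝ (Fin d₁))} {s₂ : Finset (EuclideanSpace ℝ (Fin d₂))} {ε θ : ℝ}
    (hs₁ : IsUnitBallNet s₁ ε) (hs₂ : IsUnitBallNet s₂ ε) (hε : ε ≤ 1 / 8) (hθ : 8 * K * ε ≤ θ)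
    (hnet : ∀ e₁ ∈ s₁, ∀ p ∈ s₂, ∀ e₂ ∈ s₁, ∀ q ∈ s₂, 1 / 2 ≤ frobNorm (pairMatrix e₁ p e₂ q) →
      θ ≤ signedMeanAbs Iout (matrixForm ℓ r (pairMatrix e₁ p e₂ q))) :
    IsWellConditioned ℓ r Iout K (θ / 2) := by
  refine ⟨hupper, fun a b c d => ?_⟩
  obtain ⟨e₁, p, e₂, q, h₁, h₃, hmat, hN⟩ := exists_orthogonal_pairMatrix a b c d
  have hgoal : (1 / (m : ℝ)) * ∑ i, outlierSign Iout i *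
      |inner ℝ (ℓ i) a * inner ℝ (r i) b + inner ℝ (ℓ i) c * inner ℝ (r i) d| =
      signedMeanAbs Iout (matrixForm ℓ r (pairMatrix a b c d)) := by
    rw [matrixForm_pairMatrix, signedMeanAbs]
  rw [hgoal, ← frobNorm_pairMatrix, hmat]
  set F := frobNorm (pairMatrix e₁ p e₂ q) with hFdef
  have hFsq : F ^ 2 = ‖p‖ ^ 2 + ‖q‖ ^ 2 := by rw [hFdef, ← hmat, frobNorm_pairMatrix_sq, hN]
  rcases (frobNorm_nonneg (pairMatrix e₁ p e₂ q)).eq_or_lt with h0 | h0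
  · rw [← hFdef] at h0
    rw [← h0] at hFsq
    have hp : p = 0 := norm_eq_zero.1 (by nlinarith [sq_nonneg ‖p‖, sq_nonneg ‖q‖])
    have hq : q = 0 := norm_eq_zero.1 (by nlinarith [sq_nonneg ‖p‖, sq_nonneg ‖q‖])
    rw [← h0, hp, hq, matrixForm_pairMatrix, signedMeanAbs]
    simp
  · rw [← hFdef] at h0
    have hunit : ∀ v : EuclideanSpace ℝ (Fin d₂), ‖v‖ ^ 2 ≤ F ^ 2 → ‖F⁻¹ • v‖ ≤ 1 := by
      intro v hv
      rw [norm_smul, Real.norm_of_nonneg (inv_nonneg.2 h0.le), inv_mul_le_one₀ h0]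
      exact le_of_sq_le_sq hv h0.le
    have hF1 : frobNorm (pairMatrix e₁ (F⁻¹ • p) e₂ (F⁻¹ • q)) = 1 := by
      rw [pairMatrix_smul, frobNorm_smul, abs_of_pos (inv_pos.2 h0), ← hFdef,
        inv_mul_cancel₀ h0.ne']
    have hlow := le_signedMeanAbs_of_net hK hupper hs₁ hs₂ hε hθ hnet h₁
      (hunit p (by rw [hFsq]; linarith [sq_nonneg ‖q‖])) h₃
      (hunit q (by rw [hFsq]; linarith [sq_nonneg ‖p‖])) hF1
    rw [pairMatrix_smul, matrixForm_smul, signedMeanAbs_smul _ (inv_nonneg.2 h0.le),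
      le_inv_mul_iff₀ h0] at hlow
    linarith

end NetToAll

/-! ### The high-probability event -/

section Event

variable {Ω : Type*} [MeasurableSpace Ω] {P : Measure Ω} [IsProbabilityMeasure P] {m d₁ d₂ : ℕ}
  {ℓ : Fin m → Ω → EuclideanSpace ℝ (Fin d₁)} {r : Fin m → Ω → EuclideanSpace ℝ (Fin d₂)}
  {Dl : Measure (EuclideanSpace ℝ (Fin d₁))} {Dr : Measure (EuclideanSpace ℝ (Fin d₂))}
  {η μ₀ p₀ : ℝ}

/-- Upper tail of the empirical second moments of a sub-gaussian vector in a fixed direction. -/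
lemma measureReal_sum_inner_sq_le {V : Type*} [MeasurableSpace V] {D : Measure V} {d : ℕ}
    {X : Fin m → Ω → V} (hlaw : ∀ i, HasLaw (X i) D P) (hindep : iIndepFun X P) (hη : 0 < η)
    {π : V → EuclideanSpace ℝ (Fin d)} (hπ : Measurable π)
    {D' : Measure (EuclideanSpace ℝ (Fin d))} [IsProbabilityMeasure D']
    (hmap : D.map π = D') (hsub : IsSubGaussianLaw η D') {c : EuclideanSpace ℝ (Fin d)}
    (hc : ‖c‖ ≤ 1) :
    P.real {ω | 3 * η ^ 2 * m ≤ ∑ i, (inner ℝ (π (X i ω)) c) ^ 2} ≤ Real.exp (-(2 * m)) := by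
  obtain ⟨hi, hb⟩ := integrable_exp_inner_sq hsub hc
  have hmeas : Measurable fun a : EuclideanSpace ℝ (Fin d) =>
      Real.exp ((inner ℝ a c) ^ 2 / η ^ 2) := by fun_prop
  rw [← hmap] at hi hb
  rw [integral_map hπ.aemeasurable hmeas.aestronglyMeasurable] at hb
  have hi' := hi.comp_measurable hπ
  have key := measureReal_le_sum_le_exp hlaw hindep
    (g := fun _ a => (inner ℝ (π a) c) ^ 2 / η ^ 2) (fun _ => by fun_prop)
    (b := fun _ => Real.log 2) (fun _ => hi')
    (fun _ => by rw [Real.exp_log (by norm_num)]; exact hb) (3 * m)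
  refine le_trans (measureReal_mono ?_) (key.trans (Real.exp_le_exp.2 ?_))
  · intro ω hω
    simp only [Set.mem_ofPred_eq] at hω ⊢
    rw [← Finset.sum_div, le_div_iff₀ (by positivity)]
    linarith
  · rw [Finset.sum_const, Finset.card_univ, Fintype.card_fin, nsmul_eq_mul]
    have hm : (0 : ℝ) ≤ m := Nat.cast_nonneg m
    have : (m : ℝ) * Real.log 2 ≤ m * 1 :=
      mul_le_mul_of_nonneg_left (by linarith [Real.log_two_lt_d9]) hm
    linarith

/-- Lower tail of the signed mean of a single matrix whose factors lie in the unit balls. -/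
lemma measureReal_signedMeanAbs_lt_le (hη : 0 < η) (hμ₀ : 0 < μ₀) (hp₀ : 0 < p₀)
    (hmodel : IsSubGaussianModel P ℓ r Dl Dr η μ₀ p₀) (hm : 0 < m) {Iout : Finset (Fin m)} {Δ : ℝ}
    (hΔ0 : 0 ≤ Δ) (hΔ1 : Δ ≤ 1) (hΔ : Δ * m = m - 2 * Iout.card)
    {e₁ e₂ : EuclideanSpace ℝ (Fin d₁)} {p q : EuclideanSpace ℝ (Fin d₂)}
    (h₁ : ‖e₁‖ ≤ 1) (h₂ : ‖p‖ ≤ 1) (h₃ : ‖e₂‖ ≤ 1) (h₄ : ‖q‖ ≤ 1)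
    (hF : 1 / 2 ≤ frobNorm (pairMatrix e₁ p e₂ q)) :
    P.real {ω | signedMeanAbs Iout (matrixForm (fun i => ℓ i ω) (fun i => r i ω)
      (pairMatrix e₁ p e₂ q)) < Δ * (μ₀ * p₀) / 4} ≤
      Real.exp (-(Δ ^ 2 * (μ₀ * p₀ / (4 * η ^ 2)) ^ 2 * m / 256)) := by
  have := hmodel.isProb_left
  have := hmodel.isProb_right
  have hm' : (0 : ℝ) < m := by exact_mod_cast hm
  obtain ⟨hi, hb⟩ := integrable_exp_scaledForm hmodel.subGaussian_left hmodel.subGaussian_right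
    h₁ h₂ h₃ h₄
  have hmean := le_integral_scaledForm hη hμ₀ hmodel.nondegenerate
    (integrable_of_exp measurable_scaledForm scaledForm_nonneg hi) hF
  refine le_trans (measureReal_mono ?_) (measureReal_signed_sum_le hmodel.law hmodel.indep
    measurable_scaledForm scaledForm_nonneg hi hb (outlierSign_eq Iout) hΔ0 hΔ1
    (by rw [sum_outlierSign, hΔ]) (by positivity) hmean)
  intro ω hω
  simp only [Set.mem_ofPred_eq] at hω ⊢
  rw [signedMeanAbs, matrixForm_pairMatrix, one_div, inv_mul_lt_iff₀ hm'] at hω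
  simp only [scaledForm, mul_div_assoc']
  rw [← Finset.sum_div, div_le_iff₀ (by positivity)]
  refine hω.le.trans (le_of_eq ?_)
  field_simp

/-- The complement of finitely many small sets, none of them assumed measurable, contains a
measurable event of large probability. -/
lemma exists_measurableSet_of_finset_bad {ι : Type*} (s : Finset ι) (B : ι → Set Ω) :
    ∃ A : Set Ω, MeasurableSet A ∧ 1 - ∑ i ∈ s, P.real (B i) ≤ P.real A ∧
      ∀ ω ∈ A, ∀ i ∈ s, ω ∉ B i := by
  refine ⟨(toMeasurable P (⋃ i ∈ s, B i))ᶜ, (measurableSet_toMeasurable _ _).compl, ?_, ?_⟩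
  · rw [probReal_compl_eq_one_sub (measurableSet_toMeasurable _ _), measureReal_def,
      measure_toMeasurable, ← measureReal_def]
    have := measureReal_biUnion_finset_le (μ := P) s B
    linarith
  · intro ω hω i hi hωi
    exact hω (subset_toMeasurable _ _ (Set.mem_biUnion hi hωi))

lemma card_mul_exp_le {N : ℕ} {C x y : ℝ} {k : ℕ} (hC : 0 < C) (hN : (N : ℝ) ≤ C ^ k)
    (h : k * Real.log C ≤ x - y) : N * Real.exp (-x) ≤ Real.exp (-y) := by
  have e : C ^ k = Real.exp (k * Real.log C) := by
    rw [Real.exp_nat_mul, Real.exp_log hC]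
  calc _ ≤ Real.exp (k * Real.log C) * Real.exp (-x) :=
        mul_le_mul_of_nonneg_right (hN.trans_eq e) (Real.exp_pos _).le
    _ = Real.exp (k * Real.log C + -x) := (Real.exp_add _ _).symm
    _ ≤ _ := Real.exp_le_exp.2 (by linarith)

/-- Union bound over nets: three families of exceptional events are excluded, for the empirical
second moments of the `ℓ_i` and of the `r_i`, and for the signed means. -/
theorem exists_event_isWellConditioned (hη : 0 < η) (hμ₀ : 0 < μ₀) (hp₀ : 0 < p₀)
    (hmodel : IsSubGaussianModel P ℓ r Dl Dr η μ₀ p₀) (hm : 0 < m) {Iout : Finset (Fin m)}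
    {Δ ε : ℝ} (hΔ0 : 0 ≤ Δ) (hΔ1 : Δ ≤ 1) (hΔ : Δ * m = m - 2 * Iout.card) (hε0 : 0 < ε)
    (hε : ε ≤ 1 / 8) (hεθ : 8 * (12 * η ^ 2) * ε ≤ Δ * (μ₀ * p₀) / 4) {y : ℝ}
    (hy₁ : d₁ * Real.log 6 ≤ 2 * m - y) (hy₂ : d₂ * Real.log 6 ≤ 2 * m - y)
    (hy₃ : ((d₁ + d₂ + (d₁ + d₂) : ℕ) : ℝ) * Real.log (3 / ε) ≤
      Δ ^ 2 * (μ₀ * p₀ / (4 * η ^ 2)) ^ 2 * m / 256 - y) :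
    ∃ A : Set Ω, MeasurableSet A ∧ 1 - 3 * Real.exp (-y) ≤ P.real A ∧
      ∀ ω ∈ A, IsWellConditioned (fun i => ℓ i ω) (fun i => r i ω) Iout (12 * η ^ 2)
        (Δ * (μ₀ * p₀) / 8) := by
  classical
  have := hmodel.isProb_left
  have := hmodel.isProb_right
  obtain ⟨n₁, hn₁, cn₁⟩ := exists_isUnitBallNet (EuclideanSpace ℝ (Fin d₁))
    (by norm_num : (0 : ℝ) < 1 / 2) (by norm_num)
  obtain ⟨n₂, hn₂, cn₂⟩ := exists_isUnitBallNet (EuclideanSpace ℝ (Fin d₂))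
    (by norm_num : (0 : ℝ) < 1 / 2) (by norm_num)
  obtain ⟨s₁, hs₁, cs₁⟩ := exists_isUnitBallNet (EuclideanSpace ℝ (Fin d₁)) hε0 (by linarith)
  obtain ⟨s₂, hs₂, cs₂⟩ := exists_isUnitBallNet (EuclideanSpace ℝ (Fin d₂)) hε0 (by linarith)
  rw [finrank_euclideanSpace_fin] at cn₁ cn₂ cs₁ cs₂
  norm_num only at cn₁ cn₂
  obtain ⟨A₁, mA₁, pA₁, hA₁⟩ := exists_measurableSet_of_finset_bad (P := P) n₁
    fun c => {ω | 3 * η ^ 2 * m ≤ ∑ i, (inner ℝ (ℓ i ω) c) ^ 2}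
  obtain ⟨A₂, mA₂, pA₂, hA₂⟩ := exists_measurableSet_of_finset_bad (P := P) n₂
    fun c => {ω | 3 * η ^ 2 * m ≤ ∑ i, (inner ℝ (r i ω) c) ^ 2}
  obtain ⟨A₃, mA₃, pA₃, hA₃⟩ := exists_measurableSet_of_finset_bad (P := P)
    (((s₁ ×ˢ s₂) ×ˢ (s₁ ×ˢ s₂)).filter
      fun t => 1 / 2 ≤ frobNorm (pairMatrix t.1.1 t.1.2 t.2.1 t.2.2))
    fun t => {ω | signedMeanAbs Iout (matrixForm (fun i => ℓ i ω) (fun i => r i ω)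
      (pairMatrix t.1.1 t.1.2 t.2.1 t.2.2)) < Δ * (μ₀ * p₀) / 4}
  have b₁ : ∑ c ∈ n₁, P.real {ω | 3 * η ^ 2 * m ≤ ∑ i, (inner ℝ (ℓ i ω) c) ^ 2} ≤
      Real.exp (-y) := by
    refine (Finset.sum_le_card_nsmul _ _ _ fun c hc => measureReal_sum_inner_sq_le hmodel.law
      hmodel.indep hη measurable_fst (D' := Dl) ?_ hmodel.subGaussian_left
      (hn₁.norm_le_one c hc)).trans ?_
    · simp
    · rw [nsmul_eq_mul]
      exact card_mul_exp_le (by norm_num) cn₁ hy₁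
  have b₂ : ∑ c ∈ n₂, P.real {ω | 3 * η ^ 2 * m ≤ ∑ i, (inner ℝ (r i ω) c) ^ 2} ≤
      Real.exp (-y) := by
    refine (Finset.sum_le_card_nsmul _ _ _ fun c hc => measureReal_sum_inner_sq_le hmodel.law
      hmodel.indep hη measurable_snd (D' := Dr) ?_ hmodel.subGaussian_right
      (hn₂.norm_le_one c hc)).trans ?_
    · simp
    · rw [nsmul_eq_mul]
      exact card_mul_exp_le (by norm_num) cn₂ hy₂
  have b₃ : ∑ t ∈ ((s₁ ×ˢ s₂) ×ˢ (s₁ ×ˢ s₂)).filter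
      fun t => 1 / 2 ≤ frobNorm (pairMatrix t.1.1 t.1.2 t.2.1 t.2.2),
      P.real {ω | signedMeanAbs Iout (matrixForm (fun i => ℓ i ω) (fun i => r i ω)
        (pairMatrix t.1.1 t.1.2 t.2.1 t.2.2)) < Δ * (μ₀ * p₀) / 4} ≤ Real.exp (-y) := by
    refine (Finset.sum_le_card_nsmul _ _
      (Real.exp (-(Δ ^ 2 * (μ₀ * p₀ / (4 * η ^ 2)) ^ 2 * m / 256))) fun t ht => ?_).trans ?_
    · obtain ⟨ht, hF⟩ := Finset.mem_filter.1 ht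
      obtain ⟨ht1, ht2⟩ := Finset.mem_product.1 ht
      obtain ⟨h1, h2⟩ := Finset.mem_product.1 ht1
      obtain ⟨h3, h4⟩ := Finset.mem_product.1 ht2
      exact measureReal_signedMeanAbs_lt_le hη hμ₀ hp₀ hmodel hm hΔ0 hΔ1 hΔ
        (hs₁.norm_le_one _ h1) (hs₂.norm_le_one _ h2) (hs₁.norm_le_one _ h3)
        (hs₂.norm_le_one _ h4) hF
    · rw [nsmul_eq_mul]
      refine card_mul_exp_le (by positivity) ?_ hy₃
      refine (Nat.cast_le.2 (Finset.card_filter_le _ _)).trans ?_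
      rw [Finset.card_product, Finset.card_product, pow_add, pow_add]
      push_cast
      gcongr
  refine ⟨A₁ ∩ A₂ ∩ A₃, (mA₁.inter mA₂).inter mA₃, ?_, ?_⟩
  · have hinter : ∀ S T : Set Ω, MeasurableSet T → P.real S + P.real T - 1 ≤ P.real (S ∩ T) := by
      intro S T hT
      have h1 := measureReal_union_add_inter (μ := P) (s := S) hT
      have h2 : P.real (S ∪ T) ≤ 1 := measureReal_le_one
      linarith
    have h1 := hinter A₁ A₂ mA₂
    have h2 := hinter (A₁ ∩ A₂) A₃ mA₃
    linarith
  · rintro ω ⟨⟨hω₁, hω₂⟩, hω₃⟩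
    have hupper := meanAbs_mul_le_of_net (ℓ := fun i => ℓ i ω) (r := fun i => r i ω) hn₁ hn₂ hm
      (B := 3 * η ^ 2) (by positivity) (fun c hc => (not_le.1 (hA₁ ω hω₁ c hc)).le)
      (fun c hc => (not_le.1 (hA₂ ω hω₂ c hc)).le)
    have e : 4 * (3 * η ^ 2) = 12 * η ^ 2 := by ring
    rw [e] at hupper
    have e' : Δ * (μ₀ * p₀) / 8 = Δ * (μ₀ * p₀) / 4 / 2 := by ring
    rw [e']
    refine isWellConditioned_of_net (by positivity) hupper hs₁ hs₂ hε hεθ ?_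
    intro e₁ h1 p h2 e₂ h3 q h4 hF
    refine not_lt.1 (hA₃ ω hω₃ ((e₁, p), (e₂, q)) (Finset.mem_filter.2 ⟨?_, hF⟩))
    exact Finset.mem_product.2 ⟨Finset.mem_product.2 ⟨h1, h2⟩, Finset.mem_product.2 ⟨h3, h4⟩⟩

end Event

/-! ### Constants and rates -/

section Rates

variable {E : Type*} [NormedAddCommGroup E] [InnerProductSpace ℝ E]

/-- The convergence guarantees in the form in which `t / c` measures the conditioning of the
problem and distances are measured in units of `√M`. -/
theorem IsSharpWeaklyConvex.rates {f : E → ℝ} {Q S : Set E} {fstar t c ν M : ℝ} (ht : 0 < t)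
    (htc : t ≤ c) (hν : 1 ≤ ν) (hM : 0 < M)
    (h : IsSharpWeaklyConvex f Q S fstar (t * √M / (2 * √2 * (ν + 1))) c (√2 * (c * (ν * √M))))
    {z : ℕ → E} (hd : Metric.infDist (z 0) S / √M ≤ t / (4 * √2 * c * (ν + 1))) :
    (z 0 ∈ Q → IsPolyakRun f Q z → ∀ k : ℕ, Metric.infDist (z k) S ^ 2 / M ≤
      (1 - t ^ 2 / (32 * c ^ 2 * (ν + 1) ^ 4)) ^ k * (t ^ 2 / (32 * c ^ 2 * (ν + 1) ^ 2))) ∧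
    (z 0 ∈ Q → IsGeometricRun f Q (t ^ 2 * √M / (16 * √2 * c ^ 2 * ν * (ν + 1) ^ 2))
        (√(1 - t ^ 2 / (32 * c ^ 2 * (ν + 1) ^ 4))) z →
      ∀ k : ℕ, Metric.infDist (z k) S ^ 2 / M ≤
        (1 - t ^ 2 / (32 * c ^ 2 * (ν + 1) ^ 4)) ^ k * (t ^ 2 / (32 * c ^ 2 * (ν + 1) ^ 2))) ∧
    (∀ ψ : E → E → ℝ, (∀ z y, |f y - ψ z y| ≤ c / 2 * ‖y - z‖ ^ 2) →
      (∀ k, z (k + 1) ∈ argminSet (fun u => ψ (z k) u + c / 2 * ‖u - z k‖ ^ 2) Q) →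
      ∀ k : ℕ, Metric.infDist (z k) S / √M ≤
        ((2 : ℝ) ^ (2 ^ k : ℕ))⁻¹ * (t / (2 * √2 * c * (ν + 1)))) := by
  have hc : 0 < c := ht.trans_le htc
  have hν0 : 0 < ν := by linarith
  have hs2 : √2 ^ 2 = (2 : ℝ) := Real.sq_sqrt (by norm_num)
  have hsM : √M ^ 2 = M := Real.sq_sqrt hM.le
  have hs : 0 < √M := Real.sqrt_pos.2 hM
  have hs2pos : 0 < √(2 : ℝ) := by positivity
  set s := √(2 : ℝ)
  set w := √M
  set R := t * w / (4 * s * c * (ν + 1)) with hR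
  set κ := t ^ 2 / (32 * c ^ 2 * (ν + 1) ^ 4) with hκ
  have hκ0 : 0 ≤ κ := by positivity
  have hratio : t ^ 2 ≤ c ^ 2 := pow_le_pow_left₀ ht.le htc 2
  have hν4 : 1 ≤ (ν + 1) ^ 4 := one_le_pow₀ (by linarith)
  have hκ1 : κ ≤ 1 := by
    rw [hκ, div_le_one (by positivity)]
    have : c ^ 2 ≤ c ^ 2 * (ν + 1) ^ 4 := le_mul_of_one_le_right (by positivity) hν4
    nlinarith
  have hdR : Metric.infDist (z 0) S ≤ R := by
    rw [div_le_iff₀ hs] at hd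
    refine hd.trans (le_of_eq ?_)
    rw [hR]; ring
  have hRμ : R = t * w / (2 * s * (ν + 1)) / (2 * c) := by
    rw [hR]; field_simp; norm_num
  have hR2 : ∀ k, (1 - κ) ^ k * R ^ 2 / M = (1 - κ) ^ k * (t ^ 2 / (32 * c ^ 2 * (ν + 1) ^ 2)) := by
    intro k
    rw [hR, ← hsM, div_pow, mul_pow, mul_pow, mul_pow, mul_pow, hs2]
    field_simp; ring
  have hν2 : ν ^ 2 ≤ (ν + 1) ^ 2 := pow_le_pow_left₀ hν0.le (by linarith) 2
  refine ⟨fun h0 hz k => ?_, fun h0 hz k => ?_, fun ψ hψ hz k => ?_⟩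
  · have key := h.polyak hκ1 hκ0 ?_ hz h0 hRμ.le hdR k
    · rw [← hR2]
      exact div_le_div_of_nonneg_right key hM.le
    · have e1 : 2 * (s * (c * (ν * w))) ^ 2 * κ =
          t ^ 2 * M / (8 * (ν + 1) ^ 2) * (ν ^ 2 / (ν + 1) ^ 2) := by
        rw [mul_pow, mul_pow, mul_pow, hs2, hsM, hκ]; field_simp; norm_num
      have e2 : (t * w / (2 * s * (ν + 1))) ^ 2 = t ^ 2 * M / (8 * (ν + 1) ^ 2) := by
        rw [div_pow, mul_pow, mul_pow, mul_pow, hs2, hsM]; ring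
      rw [e1, e2]
      exact mul_le_of_le_one_right (by positivity) ((div_le_one (by positivity)).2 hν2)
  · set τ := t / (4 * c * ν * (ν + 1)) with hτ
    have hτμ : τ = t * w / (2 * s * (ν + 1)) / (s * (c * (ν * w))) := by
      have : t * w / (2 * s * (ν + 1)) / (s * (c * (ν * w))) =
          t * w / (2 * s ^ 2 * (ν + 1) * (c * (ν * w))) := by
        rw [div_div]; congr 1; ring
      rw [this, hs2, hτ]; field_simp; norm_num
    have hlam : t ^ 2 * w / (16 * s * c ^ 2 * ν * (ν + 1) ^ 2) = τ * R := by
      rw [hτ, hR]; field_simp; norm_num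
    have hτ1 : τ ^ 2 ≤ 1 / 2 := by
      have hτle : τ ≤ 1 / 2 := by
        rw [hτ, div_le_div_iff₀ (by positivity) (by norm_num)]
        have h1 : 1 ≤ ν * (ν + 1) := by nlinarith
        have h2 : c ≤ c * (ν * (ν + 1)) := le_mul_of_one_le_right hc.le h1
        linarith
      have hτ0 : 0 ≤ τ := by positivity
      nlinarith
    have hκτ : 2 * κ ≤ τ ^ 2 := by
      have e1 : 2 * κ = t ^ 2 / (16 * c ^ 2 * (ν + 1) ^ 2) * (1 / (ν + 1) ^ 2) := by
        rw [hκ]; field_simp; norm_num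
      have e2 : τ ^ 2 = t ^ 2 / (16 * c ^ 2 * (ν + 1) ^ 2) * (1 / ν ^ 2) := by
        rw [hτ]; field_simp; norm_num
      rw [e1, e2]
      gcongr
    rw [hlam] at hz
    have key := h.geometric (by positivity) hτμ hτ1 (Real.sqrt_nonneg _)
      (Real.sq_sqrt (by linarith)) hκ0 hκτ hz h0 hRμ.le hdR k
    rw [← hR2]
    exact div_le_div_of_nonneg_right key hM.le
  · have key := h.proxLinear hψ hz (hdR.trans hRμ.le) k
    rw [div_le_iff₀ hs]
    refine key.trans (le_of_eq ?_)
    field_simp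

/-- The sample size requirement makes every exponent in the union bound large enough. -/
lemma sample_size_bounds {a ε₀ c₁ c₂ c₃ Δ : ℝ} {m d₁ d₂ : ℕ} (ha : 0 < a) (hε₀ : 0 < ε₀)
    (hε₀' : ε₀ ≤ 1 / 8) (hc₁ : c₁ = 1024 / a ^ 2 + 1) (hc₂ : c₂ = 3 / ε₀)
    (hc₃ : c₃ = min 1 (a ^ 2 / 512)) (hΔ0 : 0 < Δ) (hΔ1 : Δ ≤ 1)
    (hm : c₁ * ((d₁ : ℝ) + d₂ + 1) / Δ ^ 2 * Real.log (c₂ + c₂ / Δ) ≤ m) :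
    0 < m ∧ d₁ * Real.log 6 ≤ 2 * m - c₃ * Δ ^ 2 * m ∧
      d₂ * Real.log 6 ≤ 2 * m - c₃ * Δ ^ 2 * m ∧
      ((d₁ + d₂ + (d₁ + d₂) : ℕ) : ℝ) * Real.log (3 / (ε₀ * Δ)) ≤
        Δ ^ 2 * a ^ 2 * m / 256 - c₃ * Δ ^ 2 * m := by
  have hc₂24 : 24 ≤ c₂ := by rw [hc₂, le_div_iff₀ hε₀]; linarith
  have hc₂Δ : 0 ≤ c₂ / Δ := by positivity
  set L := Real.log (c₂ + c₂ / Δ)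
  have hL6 : Real.log 6 ≤ L := Real.log_le_log (by norm_num) (by linarith)
  have hlog6 : 0 < Real.log 6 := Real.log_pos (by norm_num)
  have hL3 : Real.log (3 / (ε₀ * Δ)) ≤ L := by
    refine Real.log_le_log (by positivity) ?_
    have : 3 / (ε₀ * Δ) = c₂ / Δ := by rw [hc₂, div_div]
    linarith
  have hL0 : 0 < L := hlog6.trans_le hL6
  have hΔ2 : Δ ^ 2 ≤ 1 := pow_le_one₀ hΔ0.le hΔ1
  have hΔ2pos : 0 < Δ ^ 2 := by positivity
  set d : ℝ := (d₁ : ℝ) + d₂ + 1 with hd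
  have hd1 : (0 : ℝ) ≤ d₁ := Nat.cast_nonneg _
  have hd2 : (0 : ℝ) ≤ d₂ := Nat.cast_nonneg _
  have hdL : 0 < d * L := by positivity
  have hmΔ : c₁ * (d * L) ≤ m * Δ ^ 2 := by
    rw [div_mul_eq_mul_div, div_le_iff₀ hΔ2pos] at hm
    linarith
  have hc₁1 : 1 ≤ c₁ := by
    have : 0 ≤ 1024 / a ^ 2 := by positivity
    rw [hc₁]
    linarith
  have hm0 : (0 : ℝ) ≤ m := Nat.cast_nonneg _
  have hdLm : d * L ≤ m * Δ ^ 2 := (le_mul_of_one_le_left hdL.le hc₁1).trans hmΔ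
  have hmΔm : m * Δ ^ 2 ≤ m := mul_le_of_le_one_right hm0 hΔ2
  have hc₃m : c₃ * Δ ^ 2 * m ≤ m := by
    have : c₃ * (m * Δ ^ 2) ≤ 1 * (m * Δ ^ 2) :=
      mul_le_mul_of_nonneg_right (by rw [hc₃]; exact min_le_left _ _) (by positivity)
    linarith
  have hdim : ∀ k : ℝ, 0 ≤ k → k ≤ d → k * Real.log 6 ≤ 2 * m - c₃ * Δ ^ 2 * m := by
    intro k hk0 hk
    have : k * Real.log 6 ≤ d * L := mul_le_mul hk hL6 hlog6.le (hk0.trans hk)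
    linarith
  refine ⟨?_, hdim d₁ hd1 (by linarith), hdim d₂ hd2 (by linarith), ?_⟩
  · have : (0 : ℝ) < m := by linarith
    exact_mod_cast this
  · have h1 : 1024 * (d * L) ≤ a ^ 2 * (m * Δ ^ 2) := by
      have h2 : a ^ 2 * (1024 / a ^ 2 * (d * L)) ≤ a ^ 2 * (m * Δ ^ 2) := by
        refine mul_le_mul_of_nonneg_left (le_trans ?_ hmΔ) (by positivity)
        exact mul_le_mul_of_nonneg_right (by rw [hc₁]; linarith) hdL.le
      have e : a ^ 2 * (1024 / a ^ 2 * (d * L)) = 1024 * (d * L) := by field_simp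
      linarith
    have h3 : c₃ * (m * Δ ^ 2) ≤ a ^ 2 / 512 * (m * Δ ^ 2) :=
      mul_le_mul_of_nonneg_right (by rw [hc₃]; exact min_le_right _ _) (by positivity)
    have h4 : ((d₁ + d₂ + (d₁ + d₂) : ℕ) : ℝ) * Real.log (3 / (ε₀ * Δ)) ≤ 2 * d * L := by
      refine (mul_le_mul_of_nonneg_left hL3 (Nat.cast_nonneg _)).trans ?_
      refine mul_le_mul_of_nonneg_right ?_ hL0.le
      push_cast
      linarith
    linarith

end Rates

theorem mainTheorem3 (η μ₀ p₀ : ℝ) (hη : 0 < η) (hμ₀ : 0 < μ₀) (hp₀ : 0 < p₀) :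
    ∃ c₁ c₂ c₃ c₅ c₆ : ℝ, 0 < c₁ ∧ 0 < c₂ ∧ 0 < c₃ ∧ 0 < c₅ ∧ 0 < c₆ ∧
      ∀ (Ω : Type*) [MeasurableSpace Ω] (P : Measure Ω) [IsProbabilityMeasure P]
        (m d₁ d₂ : ℕ)
        (ℓ : Fin m → Ω → EuclideanSpace ℝ (Fin d₁)) (r : Fin m → Ω → EuclideanSpace ℝ (Fin d₂))
        (Dl : Measure (EuclideanSpace ℝ (Fin d₁))) (Dr : Measure (EuclideanSpace ℝ (Fin d₂)))
        (wbar : EuclideanSpace ℝ (Fin d₁)) (xbar : EuclideanSpace ℝ (Fin d₂))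
        (Iout : Finset (Fin m)) (ξ : Fin m → Ω → ℝ) (ν pfail M : ℝ),
        IsSubGaussianModel P ℓ r Dl Dr η μ₀ p₀ →
        wbar ≠ 0 → xbar ≠ 0 → ‖wbar‖ = ‖xbar‖ →
        M = signalSize wbar xbar →
        1 ≤ ν →
        pfail = (Iout.card : ℝ) / (m : ℝ) → pfail < 1 / 2 →
        c₁ * ((d₁ : ℝ) + d₂ + 1) / (1 - 2 * pfail) ^ 2 *
            Real.log (c₂ + c₂ / (1 - 2 * pfail)) ≤ (m : ℝ) →
        -- the high-probability event, common to all initial points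
        ∃ A : Set Ω, MeasurableSet A ∧
          1 - 4 * Real.exp (-(c₃ * (1 - 2 * pfail) ^ 2 * m)) ≤ P.real A ∧
          ∀ ω ∈ A, ∀ y : Fin m → ℝ,
            y = measurements (fun i => ℓ i ω) (fun i => r i ω) wbar xbar Iout
              (fun i => ξ i ω) →
            -- the minimizers of the problem are exactly the points of the solution set
            argminSet (penalty (fun i => ℓ i ω) (fun i => r i ω) y) (feasibleSet ν wbar xbar) =
              solutionSet ν wbar xbar ∧
            ∀ z₀ : PairSpace d₁ d₂,
              Metric.infDist z₀ (solutionSet ν wbar xbar) / √M ≤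
                c₆ * (1 - 2 * pfail) / (4 * √2 * c₅ * (ν + 1)) →
              -- Polyak subgradient method
              (z₀ ∈ feasibleSet ν wbar xbar →
                ∀ z : ℕ → PairSpace d₁ d₂, z 0 = z₀ →
                  IsPolyakRun (penalty (fun i => ℓ i ω) (fun i => r i ω) y)
                    (feasibleSet ν wbar xbar) z →
                  ∀ k : ℕ, Metric.infDist (z k) (solutionSet ν wbar xbar) ^ 2 / M ≤
                    (1 - c₆ ^ 2 * (1 - 2 * pfail) ^ 2 / (32 * c₅ ^ 2 * (ν + 1) ^ 4)) ^ k *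
                      (c₆ ^ 2 * (1 - 2 * pfail) ^ 2 / (32 * c₅ ^ 2 * (ν + 1) ^ 2))) ∧
              -- subgradient method with geometrically decaying step sizes
              (z₀ ∈ feasibleSet ν wbar xbar →
                ∀ z : ℕ → PairSpace d₁ d₂, z 0 = z₀ →
                  IsGeometricRun (penalty (fun i => ℓ i ω) (fun i => r i ω) y)
                    (feasibleSet ν wbar xbar)
                    (c₆ ^ 2 * (1 - 2 * pfail) ^ 2 * √M /
                      (16 * √2 * c₅ ^ 2 * ν * (ν + 1) ^ 2))
                    (√(1 - c₆ ^ 2 * (1 - 2 * pfail) ^ 2 / (32 * c₅ ^ 2 * (ν + 1) ^ 4))) z →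
                  ∀ k : ℕ, Metric.infDist (z k) (solutionSet ν wbar xbar) ^ 2 / M ≤
                    (1 - c₆ ^ 2 * (1 - 2 * pfail) ^ 2 / (32 * c₅ ^ 2 * (ν + 1) ^ 4)) ^ k *
                      (c₆ ^ 2 * (1 - 2 * pfail) ^ 2 / (32 * c₅ ^ 2 * (ν + 1) ^ 2))) ∧
              -- prox-linear method with proximal parameter `β = c₅`
              (∀ z : ℕ → PairSpace d₁ d₂, z 0 = z₀ →
                  IsProxLinearRun meanAbs (bilinResidual (fun i => ℓ i ω) (fun i => r i ω) y)
                    (feasibleSet ν wbar xbar) c₅ z →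
                  ∀ k : ℕ, Metric.infDist (z k) (solutionSet ν wbar xbar) / √M ≤
                    ((2 : ℝ) ^ (2 ^ k : ℕ))⁻¹ *
                      (c₆ * (1 - 2 * pfail) / (2 * √2 * c₅ * (ν + 1)))) := by
  have hη2 : 0 < η ^ 2 := by positivity
  set a := μ₀ * p₀ / (4 * η ^ 2) with ha
  have ha0 : 0 < a := by positivity
  set ε₀ := min (1 / 8) (μ₀ * p₀ / (32 * (12 * η ^ 2))) with hε₀
  have hε₀0 : 0 < ε₀ := by positivity
  -- `a` bounds the mean of the scaled form from below and `ε₀ (1 - 2 pfail)` is the mesh of the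
  -- nets; capping `c₆` at `c₅` keeps the contraction factors nonnegative.
  refine ⟨1024 / a ^ 2 + 1, 3 / ε₀, min 1 (a ^ 2 / 512), 12 * η ^ 2,
    min (μ₀ * p₀ / 8) (12 * η ^ 2), by positivity, by positivity, by positivity, by positivity,
    by positivity, ?_⟩
  intro Ω _ P _ m d₁ d₂ ℓ r Dl Dr wbar xbar Iout ξ ν pfail M hmodel hw _ hwx hM hν hpfail hp hm
  set c₅ := 12 * η ^ 2 with hc₅
  set c₆ := min (μ₀ * p₀ / 8) c₅ with hc₆
  have hc₆0 : 0 < c₆ := by positivity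
  set Δ := 1 - 2 * pfail with hΔ
  have hΔ0 : 0 < Δ := by linarith
  have hΔ1 : Δ ≤ 1 := by
    have : 0 ≤ pfail := by rw [hpfail]; positivity
    linarith
  obtain ⟨hm0, hy₁, hy₂, hy₃⟩ := sample_size_bounds ha0 hε₀0 (min_le_left _ _) rfl rfl rfl hΔ0
    hΔ1 hm
  have hΔm : Δ * m = m - 2 * Iout.card := by
    have : (m : ℝ) ≠ 0 := by exact_mod_cast hm0.ne'
    rw [hΔ, hpfail]
    field_simp
  obtain ⟨A, hA, hPA, hgood⟩ := exists_event_isWellConditioned hη hμ₀ hp₀ hmodel hm0 hΔ0.le hΔ1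
    hΔm (ε := ε₀ * Δ) (by positivity)
    ((mul_le_of_le_one_right hε₀0.le hΔ1).trans (min_le_left _ _))
    (by
      have h1 : ε₀ ≤ μ₀ * p₀ / (32 * c₅) := min_le_right _ _
      rw [le_div_iff₀ (by positivity)] at h1
      have := mul_le_mul_of_nonneg_right h1 hΔ0.le
      rw [← hc₅]
      linarith)
    hy₁ hy₂ hy₃
  refine ⟨A, hA, ?_, ?_⟩
  · have := Real.exp_pos (-(min 1 (a ^ 2 / 512) * Δ ^ 2 * m))
    linarith
  rintro ω hω _ rfl
  have hwell := hgood ω hω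
  rw [← hc₅] at hwell
  have hκ : c₆ * Δ ≤ Δ * (μ₀ * p₀) / 8 := by
    have := mul_le_mul_of_nonneg_right (min_le_left (μ₀ * p₀ / 8) c₅) hΔ0.le
    linarith
  have hwell' : IsWellConditioned (fun i => ℓ i ω) (fun i => r i ω) Iout c₅ (c₆ * Δ) :=
    ⟨hwell.upper, fun a b c d => (mul_le_mul_of_nonneg_right hκ (Real.sqrt_nonneg _)).trans
      (hwell.lower a b c d)⟩
  have hc₅0 : 0 < c₅ := by positivity
  have hsharp := hwell'.isSharpWeaklyConvex hc₅0 (by positivity) hw hwx hν hM (fun i => ξ i ω)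
  refine ⟨hsharp.argminSet_eq, fun z₀ hz₀ => ?_⟩
  have hM0 : 0 < M := by
    rw [hM, signalSize_eq, ← hwx]
    positivity
  have hrates : ∀ z : ℕ → PairSpace d₁ d₂, z 0 = z₀ → _ := fun z hz =>
    hsharp.rates (z := z) (by positivity : 0 < c₆ * Δ)
      ((mul_le_of_le_one_right hc₆0.le hΔ1).trans (min_le_right _ _)) hν hM0
      (by rw [hz]; exact hz₀)
  simp only [mul_pow] at hrates
  refine ⟨fun hQ z hz hrun => ?_, fun hQ z hz hrun => ?_, fun z hz hrun => ?_⟩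
  · exact (hrates z hz).1 (hz ▸ hQ) hrun
  · exact (hrates z hz).2.1 (hz ▸ hQ) hrun
  · exact (hrates z hz).2.2 _ (fun z u => hwell'.abs_penalty_sub_le _ hc₅0.le z u) hrun
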